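/- Consider a dynamical code on $n$ qubits: a list $S_0$ of independent, pairwise commuting Pauli generators of the stabilizer group at round $0$, and rounds $M_1,\dots,M_l$ of Pauli measurements (the measurements of one round commute), made in a fixed order and without measurement errors. Paulis are taken unsigned (as Hermitian operators $i^{ab^T}\prod_j X_j^{a_j}Z_j^{b_j}$), groups $\langle\cdot\rangle$ are taken modulo phases, and a measurement of $-P$ with outcome $o$ is recorded as $P$ with outcome $-o$. When an outcome of a product of recorded operators is formed, it is the product of their outcomes, corrected by the sign with which the operator product equals the unsigned Pauli. A round-$0$ state is a state in which each $s\in S_0$ has a definite value $O(s)\in\{\pm1\}$; the signs are arbitrary, as Pauli errors at round $0$ can flip them. An element $s\in\langle S_0\rangle$ is *unmasked* if its value $O(s)$ at round $0$ is a function of the outcomes of the measurement sequence, i.e. there is a function $f$ such that for every round-$0$ state and every record $\omega$ of outcomes that has positive probability in that state, $O(s)=f(\omega)$. *Distance algorithm (part that computes the unmasked stabilizers).* Start with $C=S_0$, each $s\in C$ having itself as associated stabilizer $s\in\langle S_0\rangle$ (elements of $C$ with different associated stabilizers are kept apart, even if they are the same Pauli), and $V=\emptyset$. Each $c\in C$ carries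 its associated stabilizer $s_c$ and an outcome $O(c\cdot s_c)$ (initially $+1$), each $v\in V$ an outcome $O(v)$. For each measurement $m$ in order, with outcome $O(m)$: 1. if $m$ commutes with all of $C$ and $V$, add $m$ with $O(m)$ to $V$ if $m\notin\langle V\rangle$; 2. if $m$ commutes with all of $V$ but anti-commutes with some element of $C$, add $m$ with $O(m)$ to $V$, remove from $C$ one element $c_j$ that anti-commutes with $m$, and replace every other $c_i\in C$ that anti-commutes with $m$ by $c_ic_j$, with associated stabilizer $s_is_j$ and outcome $O(c_is_i)O(c_js_j)$; 3. if $m$ commutes with all of $C$ but anti-commutes with some element of $V$, remove from $V$ one element $m_j$ that anti-commutes with $m$, replace every other $m_i\in V$ that anti-commutes with $m$ by $m_im_j$ with outcome $O(m_i)O(m_j)$, and add $m$ with $O(m)$ to $V$; 4. if $m$ anti-commutes with some element of $C$ and with some element of $V$, update $V$ as in 3, and replace every $c_i\in C$ that anti-commutes with $m$ by $c_im_j$, with the same associated stabilizer $s_i$ and outcome $O(c_is_i)O(m_j)$. At the end compute a list $\tilde U$ of generators of $\langle C\rangle\cap\langle V\rangle$, each with an associated stabilizer inherited from $C$, including the identities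 (with their associated stabilizers) that come from the redundancies among the elements of $C$. Then go through $u\in\tilde U$, with associated stabilizer $s$: if $s\notin\langle U\rangle$, add $s$ to the output $U$ (initially empty) with outcome $O(s)=O(u)\,O(u\cdot s)$, where $O(u)$ is obtained from the outcomes of the elements of $V$. **Theorem.** For every record $\omega$ of outcomes the algorithm has an output. For every output $U$ (whatever choices are made), $U$ is independent and $\langle U\rangle$ is exactly the set of all unmasked stabilizers in $\langle S_0\rangle$. Moreover, for every $s\in\langle U\rangle$ the outcome $O(s)$ that is obtained from the outcomes in $U$ is the true value of $s$ in each round-$0$ state for which $\omega$ has positive probability. In particular, if the round-$0$ state before the error has $s=r\in\{\pm 1\}$, a Pauli error $E$ occurs at round $0$, and the record $\omega$ is then observed, $O(s)=r\,(-1)^{E\odot s}$, where $E\odot s\in\{0,1\}$ is the symplectic inner product; so the syndrome of $s$ is found. -/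

import Mathlib

namespace DynCode

/-! ## Unsigned Pauli operators -/

/-- Unsigned `n`-qubit Pauli operators (the Pauli group modulo phases), in the binary
representation `[a, b]`.  The product of Paulis modulo phases is addition, and the group
`⟨S⟩` generated by a family `S` modulo phases is `Submodule.span (ZMod 2) S`. -/
abbrev Pauli (n : ℕ) : Type := (Fin n → ZMod 2) × (Fin n → ZMod 2)

/-- Vectors of the `n`-qubit Hilbert space, as amplitudes in the computational basis. -/
abbrev QState (n : ℕ) : Type := (Fin n → ZMod 2) → ℂ

/-- The Hermitian operator `i ^ (a bᵀ) ∏ⱼ Xⱼ ^ aⱼ Zⱼ ^ bⱼ` of the unsigned Pauli `[a, b]`: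
it sends `|x⟩` to `i ^ (a bᵀ) (-1) ^ (b xᵀ) |x + a⟩`. -/
noncomputable def pauliOp {n : ℕ} (p : Pauli n) :
    Matrix (Fin n → ZMod 2) (Fin n → ZMod 2) ℂ :=
  fun y x =>
    if y = x + p.1 then
      Complex.I ^ (∑ j, (p.1 j).val * (p.2 j).val) * (-1) ^ (∑ j, (p.2 j).val * (x j).val)
    else 0

/-- The symplectic inner product `p ⊙ q`: it is `0` if the operators commute, and `1` if they
anti-commute. -/
def symp {n : ℕ} (p q : Pauli n) : ZMod 2 :=
  ∑ j, (p.1 j * q.2 j + p.2 j * q.1 j)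

/-- The exponent `k` modulo `4` in `pauliOp p * pauliOp q = i ^ k • pauliOp (p + q)`. -/
def phaseExp {n : ℕ} (p q : Pauli n) : ZMod 4 :=
  ∑ j, (((p.1 j).val * (p.2 j).val + (q.1 j).val * (q.2 j).val
      + 2 * ((p.2 j).val * (q.1 j).val) : ℕ)
    - (((p.1 j + q.1 j).val * (p.2 j + q.2 j).val : ℕ) : ZMod 4))

/-- For commuting `p` and `q`, where `phaseExp p q` is `0` or `2`, this is the sign `ε` in
`pauliOp p * pauliOp q = ε • pauliOp (p + q)`. -/
def prodSign {n : ℕ} (p q : Pauli n) : ℤˣ :=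
  if phaseExp p q = 0 then 1 else -1

/-! ## Dynamical codes and their measurement records -/

/-- A signed Hermitian Pauli operator `± P`. -/
structure SignedPauli (n : ℕ) where
  sign : ℤˣ
  pauli : Pauli n

/-- A dynamical code on `n` qubits, with the (independent, commuting) generators `S₀` of its
stabilizer group at round `0`, and rounds `M₁, …, M_l` of commuting Pauli measurements, the
measurements of a round being listed in the order in which they are made. -/
structure DynamicalCode (n : ℕ) where
  S₀ : List (Pauli n)
  S₀_comm : ∀ s ∈ S₀, ∀ t ∈ S₀, symp s t = 0
  S₀_indep : LinearIndependent (ZMod 2) (fun i : Fin S₀.length => S₀.get i)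
  rounds : List (List (SignedPauli n))
  rounds_comm : ∀ M ∈ rounds, ∀ m ∈ M, ∀ m' ∈ M, symp m.pauli m'.pauli = 0

/-- The measurements in temporal order. -/
def DynamicalCode.measurements {n : ℕ} (Q : DynamicalCode n) : List (SignedPauli n) :=
  Q.rounds.flatten

/-- The group `⟨S₀⟩`, modulo phases. -/
def DynamicalCode.isg₀ {n : ℕ} (Q : DynamicalCode n) : Submodule (ZMod 2) (Pauli n) :=
  Submodule.span (ZMod 2) {s | s ∈ Q.S₀}

/-- `p` has the definite value `o` in the state `ψ`: `P ψ = o ψ`. -/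
def HasValue {n : ℕ} (p : Pauli n) (o : ℤˣ) (ψ : QState n) : Prop :=
  (pauliOp p).mulVec ψ = ((o : ℤ) : ℂ) • ψ

/-- The states at round `0`: each generator in `S₀` has value `+1` or `-1`.  The
signs are arbitrary, since a Pauli error at round `0` can flip any of them. -/
def DynamicalCode.IsRoundZeroState {n : ℕ} (Q : DynamicalCode n) (ψ : QState n) : Prop :=
  ∀ s ∈ Q.S₀, ∃ o : ℤˣ, HasValue s o ψ

/-- The projection `(1 + o m) / 2` applied to `ψ`: the unnormalized state after the
measurement of `m` with outcome `o`. -/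
noncomputable def project {n : ℕ} (m : SignedPauli n) (o : ℤˣ) (ψ : QState n) : QState n :=
  (1 / 2 : ℂ) • (ψ + (((o * m.sign : ℤˣ) : ℤ) : ℂ) • (pauliOp m.pauli).mulVec ψ)

/-- The unnormalized state after a list of measurements with a list of outcomes (and `0` if the
two lists differ in length).  If `ψ` is a unit vector, then its squared norm is the probability
of the outcomes. -/
noncomputable def postState {n : ℕ} :
    List (SignedPauli n) → List ℤˣ → QState n → QState n
  | [], [], ψ => ψ
  | m :: ms, o :: os, ψ => postState ms os (project m o ψ)
  | _, _, _ => 0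

/-- The measurements of `Q`, made on `ψ`, have the record of outcomes `ω` with positive
probability. -/
def DynamicalCode.Possible {n : ℕ} (Q : DynamicalCode n) (ψ : QState n) (ω : List ℤˣ) : Prop :=
  postState Q.measurements ω ψ ≠ 0

/-- An unmasked stabilizer: an element of `⟨S₀⟩` whose value at round `0` can be
obtained (by some function `f`) from the outcomes of the measurement sequence, whatever the state
at round `0` is. -/
def DynamicalCode.IsUnmasked {n : ℕ} (Q : DynamicalCode n) (s : Pauli n) : Prop :=
  s ∈ Q.isg₀ ∧ ∃ f : List ℤˣ → ℤˣ, ∀ ψ : QState n, Q.IsRoundZeroState ψ →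
    ∀ ω : List ℤˣ, Q.Possible ψ ω → HasValue s (f ω) ψ

/-! ## The distance algorithm: the sets `C` and `V` -/

/-- An unsigned Pauli with its recorded outcome (an element of `V` or of the output `U`). -/
structure Recorded (n : ℕ) where
  pauli : Pauli n
  outcome : ℤˣ

/-- An element `c` of `C`, its associated stabilizer `s ∈ ⟨S₀⟩`, and the recorded outcome
`O(c · s)`. -/
structure Tracked (n : ℕ) where
  pauli : Pauli n
  assoc : Pauli n
  outcome : ℤˣ

/-- `v · w`, with outcome `O(v) O(w)`, up to the sign of the operator product. -/
def Recorded.mul {n : ℕ} (v w : Recorded n) : Recorded n where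
  pauli := v.pauli + w.pauli
  outcome := v.outcome * w.outcome * prodSign v.pauli w.pauli

/-- `c · d`, with associated stabilizer `s_c · s_d` and outcome `O(c · s_c) O(d · s_d)`, up to the
signs of the operator products. -/
def Tracked.mul {n : ℕ} (c d : Tracked n) : Tracked n where
  pauli := c.pauli + d.pauli
  assoc := c.assoc + d.assoc
  outcome := c.outcome * d.outcome * prodSign c.pauli d.pauli * prodSign c.assoc d.assoc

/-- `c · v` for `v ∈ V`, with the same associated stabilizer as `c` and with outcome
`O(c · s_c) O(v)`, up to the sign of the operator product. -/
def Tracked.mulRecorded {n : ℕ} (c : Tracked n) (v : Recorded n) : Tracked n where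
  pauli := c.pauli + v.pauli
  assoc := c.assoc
  outcome := c.outcome * v.outcome * prodSign c.pauli v.pauli

/-- The product of a list of recorded Paulis. -/
def Recorded.prod {n : ℕ} (L : List (Recorded n)) : Recorded n :=
  L.foldr Recorded.mul ⟨0, 1⟩

/-- The product of a list of tracked Paulis. -/
def Tracked.prod {n : ℕ} (L : List (Tracked n)) : Tracked n :=
  L.foldr Tracked.mul ⟨0, 0, 1⟩

/-- `w` is an element, with its outcome, of the group generated by `V`. -/
def Recorded.IsProductOf {n : ℕ} (w : Recorded n) (V : List (Recorded n)) : Prop :=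
  ∃ L : List (Recorded n), L.Sublist V ∧ Recorded.prod L = w

/-- `e` is an element, with its associated stabilizer and its outcome, of the group generated
by `C`. -/
def Tracked.IsProductOf {n : ℕ} (e : Tracked n) (C : List (Tracked n)) : Prop :=
  ∃ L : List (Tracked n), L.Sublist C ∧ Tracked.prod L = e

/-- The group `⟨V⟩`, modulo phases. -/
def spanRecorded {n : ℕ} (V : List (Recorded n)) : Submodule (ZMod 2) (Pauli n) :=
  Submodule.span (ZMod 2) {p | ∃ v ∈ V, v.pauli = p}

/-- The group `⟨C⟩`, modulo phases and without regard to the associated stabilizers. -/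
def spanTracked {n : ℕ} (C : List (Tracked n)) : Submodule (ZMod 2) (Pauli n) :=
  Submodule.span (ZMod 2) {p | ∃ c ∈ C, c.pauli = p}

/-- One update of `(C, V)` by the measurement of the unsigned Pauli `m` with outcome `o`.  The
element that is removed is any one that anti-commutes with `m`.  (`C` is a list, as elements with
the same Pauli but different associated stabilizers are kept apart.) -/
inductive Update {n : ℕ} (m : Pauli n) (o : ℤˣ) :
    List (Tracked n) → List (Recorded n) → List (Tracked n) → List (Recorded n) → Prop
  | case1_add (C : List (Tracked n)) (V : List (Recorded n))
      (hC : ∀ c ∈ C, symp c.pauli m = 0) (hV : ∀ v ∈ V, symp v.pauli m = 0)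
      (hm : m ∉ spanRecorded V) :
      Update m o C V C (⟨m, o⟩ :: V)
  | case1_keep (C : List (Tracked n)) (V : List (Recorded n))
      (hC : ∀ c ∈ C, symp c.pauli m = 0) (hV : ∀ v ∈ V, symp v.pauli m = 0)
      (hm : m ∈ spanRecorded V) :
      Update m o C V C V
  | case2 (C₁ C₂ : List (Tracked n)) (cj : Tracked n) (V : List (Recorded n))
      (hc : symp cj.pauli m = 1) (hV : ∀ v ∈ V, symp v.pauli m = 0) :
      Update m o (C₁ ++ cj :: C₂) V
        ((C₁ ++ C₂).map fun c => if symp c.pauli m = 1 then c.mul cj else c)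
        (⟨m, o⟩ :: V)
  | case3 (C : List (Tracked n)) (V₁ V₂ : List (Recorded n)) (mj : Recorded n)
      (hC : ∀ c ∈ C, symp c.pauli m = 0) (hv : symp mj.pauli m = 1) :
      Update m o C (V₁ ++ mj :: V₂)
        C
        (⟨m, o⟩ :: (V₁ ++ V₂).map fun v => if symp v.pauli m = 1 then v.mul mj else v)
  | case4 (C : List (Tracked n)) (V₁ V₂ : List (Recorded n)) (mj : Recorded n)
      (hC : ∃ c ∈ C, symp c.pauli m = 1) (hv : symp mj.pauli m = 1) :
      Update m o C (V₁ ++ mj :: V₂)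
        (C.map fun c => if symp c.pauli m = 1 then c.mulRecorded mj else c)
        (⟨m, o⟩ :: (V₁ ++ V₂).map fun v => if symp v.pauli m = 1 then v.mul mj else v)

/-- The successive updates by a list of measurements with a list of outcomes.  The measurement
of `- P` with outcome `o` is tracked as `P` with outcome `- o`. -/
inductive Updates {n : ℕ} :
    List (SignedPauli n) → List ℤˣ → List (Tracked n) → List (Recorded n) →
      List (Tracked n) → List (Recorded n) → Prop
  | nil (C : List (Tracked n)) (V : List (Recorded n)) : Updates [] [] C V C V
  | cons (m : SignedPauli n) (ms : List (SignedPauli n)) (o : ℤˣ) (os : List ℤˣ)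
      (C C' C'' : List (Tracked n)) (V V' V'' : List (Recorded n))
      (h : Update m.pauli (m.sign * o) C V C' V') (hs : Updates ms os C' V' C'' V'') :
      Updates (m :: ms) (o :: os) C V C'' V''

/-! ## The distance algorithm: the intersection and the output -/

/-- `Ut` is a list of generators of `⟨C⟩ ∩ ⟨V⟩`, each with an associated stabilizer inherited from
`C`, and it contains the identities, with their associated stabilizers, that come from the
redundancies among the elements of `C`. -/
structure IsIntersection {n : ℕ} (C : List (Tracked n)) (V : List (Recorded n))
    (Ut : List (Tracked n)) : Prop where
  product : ∀ u ∈ Ut, u.IsProductOf C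
  generates : spanTracked Ut = spanTracked C ⊓ spanRecorded V
  redundancies : ∀ e : Tracked n, e.IsProductOf C → e.pauli = 0 →
    e.assoc ∈ Submodule.span (ZMod 2) {s | ∃ u ∈ Ut, u.pauli = 0 ∧ u.assoc = s}

/-- The computation of the unmasked stabilizers: for each `u` in the list, with associated
stabilizer `s`, add `s` to the current `U` if `s ∉ ⟨U⟩`, with the outcome
`O(s) = O(u) O(u · s)`, where `O(u)` is obtained from the outcomes recorded in `V`. -/
inductive Extract {n : ℕ} (V : List (Recorded n)) :
    List (Tracked n) → List (Recorded n) → List (Recorded n) → Prop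
  | nil (U : List (Recorded n)) : Extract V [] U U
  | skip (u : Tracked n) (us : List (Tracked n)) (U U' : List (Recorded n))
      (h : u.assoc ∈ spanRecorded U) (hs : Extract V us U U') :
      Extract V (u :: us) U U'
  | add (u : Tracked n) (us : List (Tracked n)) (U U' : List (Recorded n)) (w : Recorded n)
      (h : u.assoc ∉ spanRecorded U) (hw : w.IsProductOf V) (hu : w.pauli = u.pauli)
      (hs : Extract V us (⟨u.assoc, w.outcome * u.outcome⟩ :: U) U') :
      Extract V (u :: us) U U'

/-- Given the measurement record `ω`, the distance algorithm can output the list `U` of unmasked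
stabilizers with their outcomes.  (The choices which the algorithm leaves open are made
arbitrarily.) -/
def DynamicalCode.Outputs {n : ℕ} (Q : DynamicalCode n) (ω : List ℤˣ)
    (U : List (Recorded n)) : Prop :=
  ∃ (C : List (Tracked n)) (V : List (Recorded n)) (Ut : List (Tracked n)),
    Updates Q.measurements ω (Q.S₀.map fun s => ⟨s, s, 1⟩) [] C V ∧
    IsIntersection C V Ut ∧
    Extract V Ut [] U

end DynCode

/-! Fix a round-0 state `ψ` and let `φ` be the state reached after some of the measurements. Two
relations persist: every `v ∈ V` has its recorded outcome in `φ` (`ValidV`), and every `c ∈ C` has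
in `φ` the value of `s_c` in `ψ` times the recorded outcome (`ValidC`). If products of `C` and of
`V` give the same Pauli, comparing its two values in `φ` yields the value of the associated
stabilizer in `ψ`. So all of `unmaskedSpan C V` is read off correctly (`WellFormed.hasValue`).
Outcomes never influence which Paulis occur (`Updates.replay`), so one run determines this group for
all records, and its elements are unmasked.

Conversely, the relations are complete: any state satisfying them at the end is, up to a nonzero
factor, the final state for the same record of some state satisfying them at the start
(`Updates.exists_preimage`). Each step is inverted by projecting onto the value of the removed
element, which anti-commutes with `m`; projecting back onto `m` then costs only a factor `1/2`. If
`s ∉ unmaskedSpan C V`, linear duality gives Paulis `E`, `F` such that `E` preserves the values of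
`V` and changes those of `C` exactly as `F` changes their associated stabilizers, while `F` flips
`s` (`exists_flip`). Pulling `E φ` back, with `F ψ` as reference, gives a round-0 state with the
same record and the opposite value of `s`, so `s` is masked.

Dependent Paulis in `C` can carry independent stabilizers. Hence the linear algebra lives on pairs
(Pauli, associated stabilizer), and the redundancies supply the pairs with trivial Pauli. -/

namespace DynCode

/-! ## The action of unsigned Paulis on states -/

/-- The power `I ^ k` for an exponent modulo `4`. -/
noncomputable def iPow (k : ZMod 4) : ℂ := Complex.I ^ k.val

theorem iPow_natCast (k : ℕ) : iPow k = Complex.I ^ k := by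
  rw [iPow, ZMod.val_natCast, ← Complex.I_pow_eq_pow_mod]

theorem iPow_add (a b : ZMod 4) : iPow (a + b) = iPow a * iPow b := by
  rw [← ZMod.natCast_zmod_val a, ← ZMod.natCast_zmod_val b, ← Nat.cast_add]
  simp only [iPow_natCast, pow_add]

theorem iPow_zero : iPow 0 = 1 := by simp [iPow]

theorem iPow_two : iPow 2 = -1 := by
  have h := iPow_natCast 2
  rw [Complex.I_sq] at h
  exact_mod_cast h

/-- The linear action of an unsigned Pauli. -/
noncomputable def pauliLin {n : ℕ} (p : Pauli n) : QState n →ₗ[ℂ] QState n :=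
  (pauliOp p).mulVecLin

theorem hasValue_iff {n : ℕ} {p : Pauli n} {o : ℤˣ} {ψ : QState n} :
    HasValue p o ψ ↔ pauliLin p ψ = ((o : ℤ) : ℂ) • ψ := Iff.rfl

theorem add_self_bits {n : ℕ} (a : Fin n → ZMod 2) : a + a = 0 :=
  funext fun j => CharTwo.add_self_eq_zero (a j)

theorem add_self_pauli {n : ℕ} (p : Pauli n) : p + p = 0 :=
  Prod.ext (add_self_bits p.1) (add_self_bits p.2)

/-- The phase, as an exponent of `I`, of `pauliOp p` on the basis vector `x`. -/
def basisPhase {n : ℕ} (p : Pauli n) (x : Fin n → ZMod 2) : ZMod 4 :=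
  ∑ j, (((p.1 j).val * (p.2 j).val + 2 * ((p.2 j).val * (x j).val) : ℕ) : ZMod 4)

theorem iPow_basisPhase {n : ℕ} (p : Pauli n) (x : Fin n → ZMod 2) :
    iPow (basisPhase p x) =
      Complex.I ^ (∑ j, (p.1 j).val * (p.2 j).val) * (-1) ^ (∑ j, (p.2 j).val * (x j).val) := by
  rw [basisPhase, ← Nat.cast_sum, iPow_natCast, Finset.sum_add_distrib, ← Finset.mul_sum,
    pow_add, pow_mul, Complex.I_sq]

theorem pauliLin_apply {n : ℕ} (p : Pauli n) (ψ : QState n) (y : Fin n → ZMod 2) :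
    pauliLin p ψ y = iPow (basisPhase p (y + p.1)) * ψ (y + p.1) := by
  have hy : y + p.1 + p.1 = y := by rw [add_assoc, add_self_bits, add_zero]
  rw [pauliLin, Matrix.mulVecLin_apply, Matrix.mulVec, dotProduct,
    Finset.sum_eq_single (y + p.1)]
  · rw [pauliOp, if_pos hy.symm, iPow_basisPhase]
  · intro x _ hx
    rw [pauliOp, if_neg, zero_mul]
    rintro rfl
    exact hx (by rw [add_assoc, add_self_bits, add_zero])
  · simp

/-- All phases are sums modulo 4 of one-qubit terms, so the identity is a finite check on five bits.
-/
theorem basisPhase_add {n : ℕ} (p q : Pauli n) (y : Fin n → ZMod 2) :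
    basisPhase p (y + p.1) + basisPhase q (y + p.1 + q.1) =
      phaseExp p q + basisPhase (p + q) (y + (p + q).1) := by
  simp only [basisPhase, phaseExp, ← Finset.sum_add_distrib]
  refine Finset.sum_congr rfl fun j _ => ?_
  simp only [Prod.fst_add, Prod.snd_add, Pi.add_apply]
  generalize p.1 j = a
  generalize p.2 j = b
  generalize q.1 j = c
  generalize q.2 j = d
  generalize y j = e
  revert a b c d e
  decide

theorem pauliLin_pauliLin {n : ℕ} (p q : Pauli n) (ψ : QState n) :
    pauliLin p (pauliLin q ψ) = iPow (phaseExp p q) • pauliLin (p + q) ψ := by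
  ext y
  rw [Pi.smul_apply, smul_eq_mul, pauliLin_apply, pauliLin_apply, pauliLin_apply, ← mul_assoc,
    ← mul_assoc, ← iPow_add, ← iPow_add, basisPhase_add, Prod.fst_add, add_assoc]

theorem pauliLin_zero {n : ℕ} (ψ : QState n) : pauliLin 0 ψ = ψ := by
  ext y
  simp [pauliLin_apply, basisPhase, iPow_zero]

theorem pauliLin_self {n : ℕ} (p : Pauli n) (ψ : QState n) : pauliLin p (pauliLin p ψ) = ψ := by
  have h : phaseExp p p = 0 := by
    refine Finset.sum_eq_zero fun j _ => ?_
    generalize p.1 j = a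
    generalize p.2 j = b
    revert a b
    decide
  rw [pauliLin_pauliLin, h, iPow_zero, one_smul, add_self_pauli, pauliLin_zero]

theorem pauliLin_ne_zero {n : ℕ} (p : Pauli n) {ψ : QState n} (h : ψ ≠ 0) : pauliLin p ψ ≠ 0 := by
  intro h0
  apply h
  rw [← pauliLin_self p ψ, h0, map_zero]

/-- Doubling, as a homomorphism from `ℤ/2` to `ℤ/4`. -/
def doubling : ZMod 2 →+ ZMod 4 :=
  AddMonoidHom.mk' (fun x => ((2 * x.val : ℕ) : ZMod 4)) (by decide)

theorem phaseExp_swap {n : ℕ} (p q : Pauli n) :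
    phaseExp p q = doubling (symp p q) + phaseExp q p := by
  simp only [phaseExp, symp, map_sum, ← Finset.sum_add_distrib]
  refine Finset.sum_congr rfl fun j _ => ?_
  generalize p.1 j = a
  generalize p.2 j = b
  generalize q.1 j = c
  generalize q.2 j = d
  revert a b c d
  decide

/-- For commuting Paulis this makes the phase exponent even, so the phase is a sign; it justifies
`prodSign`. -/
theorem castHom_phaseExp {n : ℕ} (p q : Pauli n) :
    ZMod.castHom (by norm_num : 2 ∣ 4) (ZMod 2) (phaseExp p q) = symp p q := by
  simp only [phaseExp, symp, map_sum]
  refine Finset.sum_congr rfl fun j _ => ?_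
  generalize p.1 j = a
  generalize p.2 j = b
  generalize q.1 j = c
  generalize q.2 j = d
  revert a b c d
  decide

theorem iPow_phaseExp {n : ℕ} {p q : Pauli n} (h : symp p q = 0) :
    iPow (phaseExp p q) = ((prodSign p q : ℤ) : ℂ) := by
  have h2 := castHom_phaseExp p q
  rw [h] at h2
  have key : ∀ k : ZMod 4, ZMod.castHom (by norm_num : 2 ∣ 4) (ZMod 2) k = 0 → k = 0 ∨ k = 2 := by
    decide
  rcases key _ h2 with h0 | h0
  · simp [prodSign, h0, iPow_zero]
  · have : (2 : ZMod 4) ≠ 0 := by decide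
    simp [prodSign, h0, iPow_two, this]

theorem pauliLin_mul {n : ℕ} {p q : Pauli n} (h : symp p q = 0) (ψ : QState n) :
    pauliLin p (pauliLin q ψ) = ((prodSign p q : ℤ) : ℂ) • pauliLin (p + q) ψ := by
  rw [pauliLin_pauliLin, iPow_phaseExp h]

theorem pauliLin_comm {n : ℕ} (p q : Pauli n) (ψ : QState n) :
    pauliLin p (pauliLin q ψ) =
      ((((-1) ^ (symp p q).val : ℤˣ) : ℤ) : ℂ) • pauliLin q (pauliLin p ψ) := by
  rw [pauliLin_pauliLin, pauliLin_pauliLin, phaseExp_swap, iPow_add, mul_smul, add_comm p q]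
  congr 1
  rcases (by decide : ∀ x : ZMod 2, x = 0 ∨ x = 1) (symp p q) with h | h
  · simp [h, iPow_zero]
  · rw [h, show doubling 1 = 2 from rfl, iPow_two]
    simp [ZMod.val_one]

/-! ## The symplectic inner product -/

theorem zmod_two_cases (x : ZMod 2) : x = 0 ∨ x = 1 := by
  revert x
  decide

theorem ne_one_of_eq_zero {x : ZMod 2} (h : x = 0) : ¬ x = 1 := by
  rw [h]
  decide

theorem eq_zero_of_ne_one {x : ZMod 2} (h : ¬ x = 1) : x = 0 :=
  (zmod_two_cases x).resolve_right h

theorem symp_comm {n : ℕ} (p q : Pauli n) : symp p q = symp q p := by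
  refine Finset.sum_congr rfl fun j _ => ?_
  ring

theorem symp_add_left {n : ℕ} (p q r : Pauli n) : symp (p + q) r = symp p r + symp q r := by
  simp only [symp, ← Finset.sum_add_distrib]
  refine Finset.sum_congr rfl fun j _ => ?_
  simp only [Prod.fst_add, Prod.snd_add, Pi.add_apply]
  ring

theorem symp_add_right {n : ℕ} (p q r : Pauli n) : symp p (q + r) = symp p q + symp p r := by
  rw [symp_comm, symp_add_left, symp_comm q, symp_comm r]

theorem symp_zero_right {n : ℕ} (p : Pauli n) : symp p 0 = 0 := by simp [symp]

theorem symp_smul_right {n : ℕ} (a : ZMod 2) (p q : Pauli n) :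
    symp p (a • q) = a * symp p q := by
  simp only [symp, Finset.mul_sum]
  refine Finset.sum_congr rfl fun j _ => ?_
  simp only [Prod.smul_fst, Prod.smul_snd, Pi.smul_apply, smul_eq_mul]
  ring

/-- Every linear functional on Paulis is a symplectic inner product. -/
theorem exists_symp_eq {n : ℕ} (f : Pauli n →ₗ[ZMod 2] ZMod 2) :
    ∃ E : Pauli n, ∀ p, f p = symp E p := by
  -- The two halves are exchanged because `symp` pairs the `X` part of one argument with the `Z`
  -- part of the other.
  refine ⟨(fun j => f (0, fun k => if j = k then 1 else 0),
    fun j => f (fun k => if j = k then 1 else 0, 0)), fun p => ?_⟩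
  have h1 := (f ∘ₗ LinearMap.inl _ _ _).pi_apply_eq_sum_univ p.1
  have h2 := (f ∘ₗ LinearMap.inr _ _ _).pi_apply_eq_sum_univ p.2
  have h : f p = f (p.1, 0) + f (0, p.2) := by rw [← map_add]; simp
  simp only [LinearMap.comp_apply, LinearMap.inl_apply, LinearMap.inr_apply, smul_eq_mul] at h1 h2
  rw [h, h1, h2, ← Finset.sum_add_distrib]
  refine Finset.sum_congr rfl fun j _ => ?_
  ring

/-! ## Definite values -/

theorem sign_mul_self (a : ℤˣ) : ((a : ℤ) : ℂ) * ((a : ℤ) : ℂ) = 1 := by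
  rcases Int.units_eq_one_or a with rfl | rfl <;> simp

theorem hasValue_zero {n : ℕ} (ψ : QState n) : HasValue 0 1 ψ := by
  rw [hasValue_iff, pauliLin_zero]
  simp

theorem HasValue.of_eq {n : ℕ} {p : Pauli n} {a b : ℤˣ} {ψ : QState n}
    (h : HasValue p a ψ) (hab : a = b) : HasValue p b ψ := hab ▸ h

theorem HasValue.unique {n : ℕ} {p : Pauli n} {a b : ℤˣ} {ψ : QState n} (hψ : ψ ≠ 0)
    (ha : HasValue p a ψ) (hb : HasValue p b ψ) : a = b := by
  rw [hasValue_iff] at ha hb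
  have h := smul_left_injective ℂ hψ (ha.symm.trans hb)
  exact Units.ext (Int.cast_injective h)

theorem HasValue.add {n : ℕ} {p q : Pauli n} {a b : ℤˣ} {ψ : QState n} (h : symp p q = 0)
    (ha : HasValue p a ψ) (hb : HasValue q b ψ) : HasValue (p + q) (a * b * prodSign p q) ψ := by
  rw [hasValue_iff] at *
  have hm := pauliLin_mul h ψ
  rw [hb, map_smul, ha] at hm
  have h1 : pauliLin (p + q) ψ = ((prodSign p q : ℤ) : ℂ) •
      (((prodSign p q : ℤ) : ℂ) • pauliLin (p + q) ψ) := by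
    rw [smul_smul, sign_mul_self, one_smul]
  rw [h1, ← hm, smul_smul, smul_smul]
  congr 1
  push_cast
  ring

/-- Cancels a factor of known value; this undoes the multiplications of an update when going
backwards in time. -/
theorem HasValue.of_add {n : ℕ} {p q : Pauli n} {a b : ℤˣ} {ψ : QState n} (h : symp p q = 0)
    (hab : HasValue (p + q) (a * b * prodSign p q) ψ) (hb : HasValue q b ψ) :
    HasValue p a ψ := by
  rw [hasValue_iff] at *
  have hm := pauliLin_mul h ψ
  rw [hb, map_smul, hab] at hm
  have h1 : pauliLin p ψ = ((b : ℤ) : ℂ) • (((b : ℤ) : ℂ) • pauliLin p ψ) := by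
    rw [smul_smul, sign_mul_self, one_smul]
  rw [h1, hm, smul_smul, smul_smul]
  congr 1
  push_cast
  linear_combination ((a : ℤ) : ℂ) * ((b : ℤ) : ℂ) * ((b : ℤ) : ℂ) * sign_mul_self (prodSign p q) +
    ((a : ℤ) : ℂ) * sign_mul_self b

theorem HasValue.pauliLin {n : ℕ} {p : Pauli n} {a : ℤˣ} {ψ : QState n} (q : Pauli n)
    (h : HasValue p a ψ) : HasValue p (a * (-1) ^ (symp q p).val) (pauliLin q ψ) := by
  rw [hasValue_iff] at *
  rw [pauliLin_comm, h, map_smul, smul_smul, symp_comm p q]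
  congr 1
  push_cast
  ring

/-- Two states with equal definite values on a commuting set have equal definite values on its
span. -/
theorem exists_hasValue_span {n : ℕ} {S : Set (Pauli n)} {ψ φ : QState n}
    (hcomm : ∀ s ∈ Submodule.span (ZMod 2) S, ∀ t ∈ Submodule.span (ZMod 2) S, symp s t = 0)
    (h : ∀ s ∈ S, ∃ o, HasValue s o ψ ∧ HasValue s o φ) {s : Pauli n}
    (hs : s ∈ Submodule.span (ZMod 2) S) : ∃ o, HasValue s o ψ ∧ HasValue s o φ := by
  induction hs using Submodule.span_induction with
  | mem x hx => exact h x hx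
  | zero => exact ⟨1, hasValue_zero _, hasValue_zero _⟩
  | add x y hx hy hx' hy' =>
    obtain ⟨a, ha, ha'⟩ := hx'
    obtain ⟨b, hb, hb'⟩ := hy'
    exact ⟨_, ha.add (hcomm x hx y hy) hb, ha'.add (hcomm x hx y hy) hb'⟩
  | smul a x _ hx' =>
    rcases zmod_two_cases a with rfl | rfl
    · rw [zero_smul]
      exact ⟨1, hasValue_zero _, hasValue_zero _⟩
    · rwa [one_smul]

theorem symp_span_eq_zero {n : ℕ} {S : Set (Pauli n)} (h : ∀ s ∈ S, ∀ t ∈ S, symp s t = 0)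
    {p q : Pauli n} (hp : p ∈ Submodule.span (ZMod 2) S) (hq : q ∈ Submodule.span (ZMod 2) S) :
    symp p q = 0 := by
  induction hp, hq using Submodule.span_induction₂ with
  | mem_mem x y hx hy => exact h x hx y hy
  | zero_left y _ => rw [symp_comm, symp_zero_right]
  | zero_right x _ => exact symp_zero_right x
  | add_left x y z _ _ _ h1 h2 => rw [symp_add_left, h1, h2, add_zero]
  | add_right x y z _ _ _ h1 h2 => rw [symp_add_right, h1, h2, add_zero]
  | smul_left a x y _ _ h1 => rw [symp_comm, symp_smul_right, symp_comm, h1, mul_zero]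
  | smul_right a x y _ _ h1 => rw [symp_smul_right, h1, mul_zero]

/-! ## Projections -/

/-- The projection onto the states in which `m` has value `o`. -/
noncomputable def eigenProj {n : ℕ} (m : Pauli n) (o : ℤˣ) : QState n →ₗ[ℂ] QState n :=
  (1 / 2 : ℂ) • (LinearMap.id + ((o : ℤ) : ℂ) • pauliLin m)

theorem eigenProj_apply {n : ℕ} (m : Pauli n) (o : ℤˣ) (ψ : QState n) :
    eigenProj m o ψ = (1 / 2 : ℂ) • (ψ + ((o : ℤ) : ℂ) • pauliLin m ψ) := rfl

theorem project_eq_eigenProj {n : ℕ} (m : SignedPauli n) (o : ℤˣ) (ψ : QState n) :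
    project m o ψ = eigenProj m.pauli (m.sign * o) ψ := by
  rw [mul_comm]
  rfl

theorem hasValue_eigenProj {n : ℕ} (m : Pauli n) (o : ℤˣ) (ψ : QState n) :
    HasValue m o (eigenProj m o ψ) := by
  rw [hasValue_iff, eigenProj_apply, map_smul, map_add, map_smul, pauliLin_self]
  match_scalars
  · linear_combination (-(1 / 2 : ℂ)) * sign_mul_self o
  · ring

theorem HasValue.eigenProj {n : ℕ} {p m : Pauli n} {a : ℤˣ} {ψ : QState n} (o : ℤˣ)
    (hpm : symp p m = 0) (h : HasValue p a ψ) : HasValue p a (eigenProj m o ψ) := by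
  rw [hasValue_iff] at *
  have hc := pauliLin_comm p m ψ
  simp only [hpm, ZMod.val_zero, pow_zero, Units.val_one, Int.cast_one, one_smul] at hc
  rw [eigenProj_apply, map_smul, map_add, map_smul, hc, h, map_smul]
  module

theorem HasValue.eigenProj_eq {n : ℕ} {m : Pauli n} {o : ℤˣ} {ψ : QState n}
    (h : HasValue m o ψ) : DynCode.eigenProj m o ψ = ψ := by
  rw [hasValue_iff] at h
  rw [eigenProj_apply, h, smul_smul, sign_mul_self, one_smul, ← two_smul ℂ, smul_smul]
  norm_num

/-- Since `p` anti-commutes with `m`, it sends the `o`-eigenvector `ψ` to the opposite eigenspace,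
which the outer projection kills. Thus a measurement of `m` can erase any imposed value of `p`. -/
theorem HasValue.eigenProj_eigenProj {n : ℕ} {p m : Pauli n} {o : ℤˣ} {ψ : QState n} (a : ℤˣ)
    (hpm : symp p m = 1) (h : HasValue m o ψ) :
    DynCode.eigenProj m o (DynCode.eigenProj p a ψ) = (1 / 2 : ℂ) • ψ := by
  have hm := h.eigenProj_eq
  have hp : DynCode.eigenProj m o (DynCode.pauliLin p ψ) = 0 := by
    rw [hasValue_iff] at h
    rw [eigenProj_apply, pauliLin_comm, symp_comm, hpm, h, map_smul]
    simp [ZMod.val_one, smul_smul, sign_mul_self]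
  rw [eigenProj_apply p, map_smul, map_add, map_smul, hm, hp, smul_zero, add_zero]

theorem eigenProj_add_eigenProj {n : ℕ} (m : Pauli n) (o : ℤˣ) (ψ : QState n) :
    eigenProj m o ψ + eigenProj m (-o) ψ = ψ := by
  rw [eigenProj_apply, eigenProj_apply, ← smul_add]
  have : ψ + ((o : ℤ) : ℂ) • pauliLin m ψ + (ψ + (((-o : ℤˣ) : ℤ) : ℂ) • pauliLin m ψ) =
      (2 : ℂ) • ψ := by
    push_cast
    module
  rw [this, smul_smul]
  norm_num

theorem exists_eigenProj_ne_zero {n : ℕ} (m : Pauli n) {ψ : QState n} (hψ : ψ ≠ 0) :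
    ∃ o, eigenProj m o ψ ≠ 0 := by
  by_contra! h
  apply hψ
  rw [← eigenProj_add_eigenProj m 1 ψ, h, h, add_zero]

/-- Project a nonzero vector onto the generators in turn, each time with an outcome that leaves it
nonzero; commutation preserves the values already obtained. -/
theorem exists_common_eigenstate {n : ℕ} (L : List (Pauli n))
    (hL : ∀ s ∈ L, ∀ t ∈ L, symp s t = 0) :
    ∃ ψ : QState n, ψ ≠ 0 ∧ ∀ s ∈ L, ∃ o, HasValue s o ψ := by
  induction L with
  | nil => exact ⟨fun _ => 1, fun h => one_ne_zero (congrFun h 0), by simp⟩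
  | cons m L ih =>
    obtain ⟨ψ, hψ, h⟩ := ih fun s hs t ht =>
      hL s (List.mem_cons_of_mem _ hs) t (List.mem_cons_of_mem _ ht)
    obtain ⟨o, ho⟩ := exists_eigenProj_ne_zero m hψ
    refine ⟨_, ho, fun s hs => ?_⟩
    rcases List.mem_cons.1 hs with rfl | hs'
    · exact ⟨o, hasValue_eigenProj _ _ _⟩
    · obtain ⟨a, ha⟩ := h s hs'
      exact ⟨a, ha.eigenProj o (hL s hs m List.mem_cons_self)⟩

theorem postState_nil {n : ℕ} (ψ : QState n) : postState [] [] ψ = ψ := rfl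

theorem postState_cons {n : ℕ} (m : SignedPauli n) (ms : List (SignedPauli n)) (o : ℤˣ)
    (os : List ℤˣ) (ψ : QState n) :
    postState (m :: ms) (o :: os) ψ = postState ms os (eigenProj m.pauli (m.sign * o) ψ) := by
  rw [← project_eq_eigenProj]
  rfl

theorem postState_smul {n : ℕ} (ms : List (SignedPauli n)) (os : List ℤˣ) (k : ℂ)
    (ψ : QState n) : postState ms os (k • ψ) = k • postState ms os ψ := by
  induction ms generalizing os ψ with
  | nil => cases os <;> simp [postState]
  | cons m ms ih =>
    cases os with
    | nil => simp [postState]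
    | cons o os => rw [postState_cons, postState_cons, map_smul, ih]

theorem length_eq_of_postState_ne_zero {n : ℕ} {ms : List (SignedPauli n)} {os : List ℤˣ}
    {ψ : QState n} (h : postState ms os ψ ≠ 0) : os.length = ms.length := by
  induction ms generalizing os ψ with
  | nil => cases os <;> simp_all [postState]
  | cons m ms ih =>
    cases os with
    | nil => simp [postState] at h
    | cons o os => simpa using ih (postState_cons m ms o os ψ ▸ h)

theorem ne_zero_of_postState_ne_zero {n : ℕ} {ms : List (SignedPauli n)} {os : List ℤˣ}
    {ψ : QState n} (h : postState ms os ψ ≠ 0) : ψ ≠ 0 := by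
  rintro rfl
  apply h
  simpa using postState_smul ms os 0 (0 : QState n)

theorem exists_postState_ne_zero {n : ℕ} (ms : List (SignedPauli n)) {ψ : QState n}
    (hψ : ψ ≠ 0) : ∃ os, postState ms os ψ ≠ 0 := by
  induction ms generalizing ψ with
  | nil => exact ⟨[], hψ⟩
  | cons m ms ih =>
    obtain ⟨o, ho⟩ := exists_eigenProj_ne_zero m.pauli hψ
    obtain ⟨os, hos⟩ := ih ho
    -- The projection uses the outcome times the sign of `m`, so the sign is put in here to cancel.
    refine ⟨m.sign * o :: os, ?_⟩
    rwa [postState_cons, ← mul_assoc, Int.units_mul_self, one_mul]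

/-! ## The update step -/

theorem forall_mem_map_ite {α : Type*} {L : List α} {p : α → Prop} [DecidablePred p]
    {f : α → α} {Q : α → Prop} :
    (∀ x ∈ L.map fun c => if p c then f c else c, Q x) ↔
      ∀ c ∈ L, (p c → Q (f c)) ∧ (¬ p c → Q c) := by
  rw [List.forall_mem_map]
  refine forall₂_congr fun c _ => ?_
  split_ifs with h <;> simp [h]

theorem map_ite_eq_self {α : Type*} {L : List α} {p : α → Prop} [DecidablePred p]
    {f : α → α} (h : ∀ c ∈ L, ¬ p c) : (L.map fun c => if p c then f c else c) = L :=
  (List.map_congr_left fun c hc => if_neg (h c hc)).trans (List.map_id' L)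

theorem mem_insert_middle {α : Type*} {a b : α} {L₁ L₂ : List α} :
    a ∈ L₁ ++ b :: L₂ ↔ a = b ∨ a ∈ L₁ ++ L₂ := by
  simp only [List.mem_append, List.mem_cons]
  tauto

/-- The update rules, where the two rules that remove an element of `V` are treated together. -/
theorem Update.elim {n : ℕ} {m : Pauli n} {o : ℤˣ}
    {P : List (Tracked n) → List (Recorded n) → List (Tracked n) → List (Recorded n) → Prop}
    (keep : ∀ C V, (∀ c ∈ C, symp c.pauli m = 0) → (∀ v ∈ V, symp v.pauli m = 0) →
      m ∈ spanRecorded V → P C V C V)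
    (add : ∀ C V, (∀ c ∈ C, symp c.pauli m = 0) → (∀ v ∈ V, symp v.pauli m = 0) →
      P C V C (⟨m, o⟩ :: V))
    (removeC : ∀ C₁ C₂ cj V, symp cj.pauli m = 1 → (∀ v ∈ V, symp v.pauli m = 0) →
      P (C₁ ++ cj :: C₂) V
        ((C₁ ++ C₂).map fun c => if symp c.pauli m = 1 then c.mul cj else c) (⟨m, o⟩ :: V))
    (removeV : ∀ C V₁ V₂ mj, symp mj.pauli m = 1 →
      P C (V₁ ++ mj :: V₂) (C.map fun c => if symp c.pauli m = 1 then c.mulRecorded mj else c)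
        (⟨m, o⟩ :: (V₁ ++ V₂).map fun v => if symp v.pauli m = 1 then v.mul mj else v))
    {C C' : List (Tracked n)} {V V' : List (Recorded n)} (h : Update m o C V C' V') :
    P C V C' V' := by
  cases h with
  | case1_add _ _ hC hV _ => exact add _ _ hC hV
  | case1_keep _ _ hC hV hm => exact keep _ _ hC hV hm
  | case2 C₁ C₂ cj _ hc hV => exact removeC _ _ _ _ hc hV
  | case3 _ V₁ V₂ mj hC hv =>
    -- Case 3 is case 4 with no element of `C` to be changed.
    have h := removeV C V₁ V₂ mj hv
    rwa [map_ite_eq_self fun c hc => ne_one_of_eq_zero (hC c hc)] at h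
  | case4 _ V₁ V₂ mj _ hv => exact removeV C V₁ V₂ mj hv

/-- The Paulis that occur in `C` or `V`. -/
def paulis {n : ℕ} (C : List (Tracked n)) (V : List (Recorded n)) : Set (Pauli n) :=
  {p | (∃ c ∈ C, c.pauli = p) ∨ ∃ v ∈ V, v.pauli = p}

theorem Tracked.mem_paulis {n : ℕ} {C : List (Tracked n)} {c : Tracked n} (h : c ∈ C)
    (V : List (Recorded n)) : c.pauli ∈ paulis C V := Or.inl ⟨c, h, rfl⟩

theorem Recorded.mem_paulis {n : ℕ} {V : List (Recorded n)} {v : Recorded n} (h : v ∈ V)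
    (C : List (Tracked n)) : v.pauli ∈ paulis C V := Or.inr ⟨v, h, rfl⟩

/-- The elements of `C` and `V` commute, and the associated stabilizers are in `S`. -/
structure WellFormed {n : ℕ} (S : Submodule (ZMod 2) (Pauli n)) (C : List (Tracked n))
    (V : List (Recorded n)) : Prop where
  assoc_mem : ∀ c ∈ C, c.assoc ∈ S
  comm : ∀ p ∈ paulis C V, ∀ q ∈ paulis C V, symp p q = 0

/-- Each element of `V` has its recorded outcome in the state `φ`. -/
def ValidV {n : ℕ} (φ : QState n) (V : List (Recorded n)) : Prop :=
  ∀ v ∈ V, HasValue v.pauli v.outcome φ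

/-- The value of each `c ∈ C` in the state `φ` is its recorded outcome times the value of the
associated stabilizer in the state `ψ`. -/
def ValidC {n : ℕ} (ψ φ : QState n) (C : List (Tracked n)) : Prop :=
  ∀ c ∈ C, ∃ r, HasValue c.assoc r ψ ∧ HasValue c.pauli (r * c.outcome) φ

theorem symp_add_eq_zero {n : ℕ} {p q m : Pauli n} (hp : symp p m = 1) (hq : symp q m = 1) :
    symp (p + q) m = 0 := by
  rw [symp_add_left, hp, hq]
  rfl

theorem symp_self {n : ℕ} (p : Pauli n) : symp p p = 0 :=
  Finset.sum_eq_zero fun j _ => by rw [mul_comm (p.2 j)]; exact CharTwo.add_self_eq_zero _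

/-- Multiplying two Paulis that both anti-commute with `m` gives one that commutes with it, and the
removed element was the only one left untreated. This yields the preservation of commutativity in
all cases at once. -/
theorem Update.mem_paulis {n : ℕ} {m : Pauli n} {o : ℤˣ} {C C' : List (Tracked n)}
    {V V' : List (Recorded n)} (h : Update m o C V C' V') {p : Pauli n}
    (hp : p ∈ paulis C' V') :
    p = m ∨ p ∈ Submodule.span (ZMod 2) (paulis C V) ∧ symp p m = 0 := by
  have hsub : ∀ {C V} {q : Pauli n}, q ∈ paulis C V → q ∈ Submodule.span (ZMod 2) (paulis C V) :=
    fun h => Submodule.subset_span h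
  revert hp
  suffices hs : (∀ c ∈ C', c.pauli = m ∨ c.pauli ∈ Submodule.span (ZMod 2) (paulis C V) ∧
      symp c.pauli m = 0) ∧ (∀ v ∈ V', v.pauli = m ∨
      v.pauli ∈ Submodule.span (ZMod 2) (paulis C V) ∧ symp v.pauli m = 0) by
    rintro (⟨c, hc, rfl⟩ | ⟨v, hv, rfl⟩)
    exacts [hs.1 c hc, hs.2 v hv]
  refine Update.elim (P := fun C V C' V' => (∀ c ∈ C', c.pauli = m ∨
    c.pauli ∈ Submodule.span (ZMod 2) (paulis C V) ∧ symp c.pauli m = 0) ∧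
    (∀ v ∈ V', v.pauli = m ∨ v.pauli ∈ Submodule.span (ZMod 2) (paulis C V) ∧
    symp v.pauli m = 0)) ?_ ?_ ?_ ?_ h
  · intro C V hC hV _
    exact ⟨fun c hc => .inr ⟨hsub (c.mem_paulis hc V), hC c hc⟩,
      fun v hv => .inr ⟨hsub (v.mem_paulis hv C), hV v hv⟩⟩
  · intro C V hC hV
    refine ⟨fun c hc => .inr ⟨hsub (c.mem_paulis hc V), hC c hc⟩,
      List.forall_mem_cons.2 ⟨.inl rfl, fun v hv => .inr ⟨hsub (v.mem_paulis hv C), hV v hv⟩⟩⟩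
  · intro C₁ C₂ cj V hcj hV
    refine ⟨forall_mem_map_ite.2 fun c hc => ?_,
      List.forall_mem_cons.2 ⟨.inl rfl, fun v hv => .inr ⟨hsub (v.mem_paulis hv _), hV v hv⟩⟩⟩
    have hc' := hsub (c.mem_paulis ((mem_insert_middle (b := cj)).2 (.inr hc)) V)
    have hj := hsub (cj.mem_paulis ((mem_insert_middle (L₁ := C₁) (L₂ := C₂)).2 (.inl rfl)) V)
    exact ⟨fun h => .inr ⟨add_mem hc' hj, symp_add_eq_zero h hcj⟩,
      fun h => .inr ⟨hc', eq_zero_of_ne_one h⟩⟩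
  · intro C V₁ V₂ mj hmj
    have hj := hsub (mj.mem_paulis ((mem_insert_middle (L₁ := V₁) (L₂ := V₂)).2 (.inl rfl)) C)
    refine ⟨forall_mem_map_ite.2 fun c hc => ?_,
      List.forall_mem_cons.2 ⟨.inl rfl, forall_mem_map_ite.2 fun v hv => ?_⟩⟩
    · have hc' := hsub (c.mem_paulis hc (V₁ ++ mj :: V₂))
      exact ⟨fun h => .inr ⟨add_mem hc' hj, symp_add_eq_zero h hmj⟩,
        fun h => .inr ⟨hc', eq_zero_of_ne_one h⟩⟩
    · have hv' := hsub (v.mem_paulis ((mem_insert_middle (b := mj)).2 (.inr hv)) C)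
      exact ⟨fun h => .inr ⟨add_mem hv' hj, symp_add_eq_zero h hmj⟩,
        fun h => .inr ⟨hv', eq_zero_of_ne_one h⟩⟩

theorem Update.assoc_mem {n : ℕ} {m : Pauli n} {o : ℤˣ} {C C' : List (Tracked n)}
    {V V' : List (Recorded n)} {S : Submodule (ZMod 2) (Pauli n)} (h : Update m o C V C' V')
    (hS : ∀ c ∈ C, c.assoc ∈ S) : ∀ c ∈ C', c.assoc ∈ S := by
  revert hS
  refine Update.elim (P := fun C _ C' _ => (∀ c ∈ C, c.assoc ∈ S) → ∀ c ∈ C', c.assoc ∈ S)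
    (fun _ _ _ _ _ hS => hS) (fun _ _ _ _ hS => hS) ?_ ?_ h
  · intro C₁ C₂ cj V _ _ hS
    refine forall_mem_map_ite.2 fun c hc => ?_
    have hc' := hS c (mem_insert_middle.2 (.inr hc))
    exact ⟨fun _ => add_mem hc' (hS cj (mem_insert_middle.2 (.inl rfl))), fun _ => hc'⟩
  · intro C V₁ V₂ mj _ hS
    exact forall_mem_map_ite.2 fun c hc => ⟨fun _ => hS c hc, fun _ => hS c hc⟩

theorem WellFormed.update {n : ℕ} {m : Pauli n} {o : ℤˣ} {C C' : List (Tracked n)}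
    {V V' : List (Recorded n)} {S : Submodule (ZMod 2) (Pauli n)} (hw : WellFormed S C V)
    (h : Update m o C V C' V') : WellFormed S C' V' := by
  refine ⟨h.assoc_mem hw.assoc_mem, fun p hp q hq => ?_⟩
  rcases h.mem_paulis hp with rfl | ⟨hp, hpm⟩ <;> rcases h.mem_paulis hq with rfl | ⟨hq, hqm⟩
  · exact symp_self _
  · rw [symp_comm, hqm]
  · exact hpm
  · exact symp_span_eq_zero hw.comm hp hq

theorem ValidV.update {n : ℕ} {m : Pauli n} {o : ℤˣ} {C C' : List (Tracked n)}
    {V V' : List (Recorded n)} {S : Submodule (ZMod 2) (Pauli n)} {φ : QState n}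
    (hV : ValidV φ V) (hw : WellFormed S C V) (h : Update m o C V C' V') :
    ValidV (eigenProj m o φ) V' := by
  revert hV hw
  refine Update.elim (P := fun C V C' V' => ValidV φ V → WellFormed S C V →
    ValidV (eigenProj m o φ) V') ?_ ?_ ?_ ?_ h
  · intro C V _ hVm _ hV _ v hv
    exact (hV v hv).eigenProj o (hVm v hv)
  · intro C V _ hVm hV _
    exact List.forall_mem_cons.2 ⟨hasValue_eigenProj _ _ _,
      fun v hv => (hV v hv).eigenProj o (hVm v hv)⟩
  · intro C₁ C₂ cj V _ hVm hV _
    exact List.forall_mem_cons.2 ⟨hasValue_eigenProj _ _ _,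
      fun v hv => (hV v hv).eigenProj o (hVm v hv)⟩
  · intro C V₁ V₂ mj hmj hV hw
    refine List.forall_mem_cons.2 ⟨hasValue_eigenProj _ _ _,
      forall_mem_map_ite.2 fun v hv => ?_⟩
    have hv' := mem_insert_middle (b := mj).2 (.inr hv)
    have hj := mem_insert_middle (a := mj) (L₁ := V₁) (L₂ := V₂).2 (.inl rfl)
    have hs := hw.comm _ (v.mem_paulis hv' C) _ (mj.mem_paulis hj C)
    exact ⟨fun h => ((hV v hv').add hs (hV mj hj)).eigenProj o (symp_add_eq_zero h hmj),
      fun h => (hV v hv').eigenProj o (eq_zero_of_ne_one h)⟩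

/-- Products are evaluated in `φ`, before the projection, where the factors still have definite
values; the product commutes with `m`, so its value survives. -/
theorem ValidC.update {n : ℕ} {m : Pauli n} {o : ℤˣ} {C C' : List (Tracked n)}
    {V V' : List (Recorded n)} {S : Submodule (ZMod 2) (Pauli n)} {ψ φ : QState n}
    (hC : ValidC ψ φ C) (hS : ∀ s ∈ S, ∀ t ∈ S, symp s t = 0) (hV : ValidV φ V)
    (hw : WellFormed S C V) (h : Update m o C V C' V') :
    ValidC ψ (eigenProj m o φ) C' := by
  revert hC hV hw
  refine Update.elim (P := fun C V C' V' => ValidC ψ φ C → ValidV φ V → WellFormed S C V →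
    ValidC ψ (eigenProj m o φ) C') ?_ ?_ ?_ ?_ h
  · intro C V hCm _ _ hC _ _ c hc
    obtain ⟨r, hr, hr'⟩ := hC c hc
    exact ⟨r, hr, hr'.eigenProj o (hCm c hc)⟩
  · intro C V hCm _ hC _ _ c hc
    obtain ⟨r, hr, hr'⟩ := hC c hc
    exact ⟨r, hr, hr'.eigenProj o (hCm c hc)⟩
  · intro C₁ C₂ cj V hcj _ hC _ hw
    refine forall_mem_map_ite.2 fun c hc => ?_
    have hc' := mem_insert_middle (b := cj).2 (.inr hc)
    have hj := mem_insert_middle (a := cj) (L₁ := C₁) (L₂ := C₂).2 (.inl rfl)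
    have hs := hw.comm _ (c.mem_paulis hc' V) _ (cj.mem_paulis hj V)
    have ha := hS _ (hw.assoc_mem c hc') _ (hw.assoc_mem cj hj)
    obtain ⟨r, hr, hr'⟩ := hC c hc'
    obtain ⟨t, ht, ht'⟩ := hC cj hj
    refine ⟨fun h => ⟨_, hr.add ha ht, ?_⟩, fun h => ⟨r, hr, hr'.eigenProj o (eq_zero_of_ne_one h)⟩⟩
    refine ((hr'.add hs ht').eigenProj o (symp_add_eq_zero h hcj)).of_eq ?_
    -- The sign of the product of associated stabilizers enters twice, through its value in `ψ` and
    -- through `Tracked.mul`, and squares to `1`.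
    calc _ = r * c.outcome * (t * cj.outcome) * prodSign c.pauli cj.pauli *
          (prodSign c.assoc cj.assoc * prodSign c.assoc cj.assoc) := by
            rw [Int.units_mul_self, mul_one]
      _ = _ := by simp only [Tracked.mul]; ac_rfl
  · intro C V₁ V₂ mj hmj hC hV hw
    refine forall_mem_map_ite.2 fun c hc => ?_
    have hj := mem_insert_middle (a := mj) (L₁ := V₁) (L₂ := V₂).2 (.inl rfl)
    have hs := hw.comm _ (c.mem_paulis hc _) _ (mj.mem_paulis hj C)
    obtain ⟨r, hr, hr'⟩ := hC c hc
    refine ⟨fun h => ⟨r, hr, ?_⟩, fun h => ⟨r, hr, hr'.eigenProj o (eq_zero_of_ne_one h)⟩⟩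
    refine ((hr'.add hs (hV mj hj)).eigenProj o (symp_add_eq_zero h hmj)).of_eq ?_
    simp only [Tracked.mulRecorded, mul_assoc]

theorem symp_add_self_eq_zero {n : ℕ} {p q : Pauli n} (h : symp p q = 0) :
    symp (p + q) q = 0 := by
  rw [symp_add_left, h, symp_self, add_zero]

/-- A state with the values recorded after an update arises, up to a factor, from a state with the
values recorded before it, if the outcome of the measurement is possible at all. -/
theorem Update.exists_preimage {n : ℕ} {m : Pauli n} {o : ℤˣ} {C C' : List (Tracked n)}
    {V V' : List (Recorded n)} {S : Submodule (ZMod 2) (Pauli n)} {ψ φ χ : QState n}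
    (h : Update m o C V C' V') (hS : ∀ s ∈ S, ∀ t ∈ S, symp s t = 0) (hw : WellFormed S C V)
    (hφ : ValidV φ V) (hφm : eigenProj m o φ ≠ 0) (hψ : ψ ≠ 0)
    (hψS : ∀ s ∈ S, ∃ r, HasValue s r ψ) (hV : ValidV χ V') (hC : ValidC ψ χ C') :
    ∃ (φ' : QState n) (k : ℂ), k ≠ 0 ∧ ValidV φ' V ∧ ValidC ψ φ' C ∧
      eigenProj m o φ' = k • χ := by
  revert hw hφ hV hC
  refine Update.elim (P := fun C V C' V' => WellFormed S C V → ValidV φ V → ValidV χ V' →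
    ValidC ψ χ C' → ∃ (φ' : QState n) (k : ℂ), k ≠ 0 ∧ ValidV φ' V ∧ ValidC ψ φ' C ∧
      eigenProj m o φ' = k • χ) ?_ ?_ ?_ ?_ h
  · intro C V _ _ hm hw hφ hV hC
    have hcomm : ∀ s ∈ spanRecorded V, ∀ t ∈ spanRecorded V, symp s t = 0 := fun s hs t ht =>
      symp_span_eq_zero (fun p hp q hq => hw.comm p (.inr hp) q (.inr hq)) hs ht
    -- As `m ∈ ⟨V⟩`, its value is the same in `φ` and `χ`. The outcome `o` is possible in `φ`, so it
    -- equals this value and the projection fixes `χ`.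
    obtain ⟨a, ha, ha'⟩ := exists_hasValue_span (ψ := φ) (φ := χ) hcomm
      (by rintro _ ⟨v, hv, rfl⟩; exact ⟨_, hφ v hv, hV v hv⟩) hm
    obtain rfl := (ha.eigenProj o (symp_self m)).unique hφm (hasValue_eigenProj m o φ)
    exact ⟨χ, 1, one_ne_zero, hV, hC, by rw [one_smul, ha'.eigenProj_eq]⟩
  · intro C V _ _ _ _ hV hC
    obtain ⟨hm, hV⟩ := List.forall_mem_cons.1 hV
    exact ⟨χ, 1, one_ne_zero, hV, hC, by rw [one_smul, HasValue.eigenProj_eq hm]⟩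
  · intro C₁ C₂ cj V hcj _ hw _ hV hC
    obtain ⟨hm, hV⟩ := List.forall_mem_cons.1 hV
    have hC := forall_mem_map_ite.1 hC
    have hj := mem_insert_middle (a := cj) (L₁ := C₁) (L₂ := C₂).2 (.inl rfl)
    obtain ⟨t, ht⟩ := hψS _ (hw.assoc_mem cj hj)
    -- The value of `cj`, lost in the update, is restored to what `ValidC` demands for the reference
    -- state `ψ`.
    refine ⟨eigenProj cj.pauli (t * cj.outcome) χ, 1 / 2, by norm_num, fun v hv => ?_,
      fun c hc => ?_, HasValue.eigenProj_eigenProj _ hcj hm⟩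
    · exact (hV v hv).eigenProj _ (hw.comm _ (v.mem_paulis hv _) _ (cj.mem_paulis hj V))
    · have hs := hw.comm _ (c.mem_paulis hc V) _ (cj.mem_paulis hj V)
      have ha := hS _ (hw.assoc_mem c hc) _ (hw.assoc_mem cj hj)
      rcases mem_insert_middle.1 hc with rfl | hc'
      · exact ⟨t, ht, hasValue_eigenProj _ _ _⟩
      by_cases hcm : symp c.pauli m = 1
      · obtain ⟨r, hr⟩ := hψS _ (hw.assoc_mem c hc)
        obtain ⟨r', hr', hrc⟩ := (hC c hc').1 hcm
        -- The hypothesis gives only some value of the product of associated stabilizers; as `ψ ≠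
        -- 0`, it is the product of their values, up to the sign.
        obtain rfl := hr'.unique hψ (hr.add ha ht)
        refine ⟨r, hr, HasValue.of_add hs ?_ (hasValue_eigenProj cj.pauli (t * cj.outcome) χ)⟩
        refine (hrc.eigenProj _ (symp_add_self_eq_zero hs)).of_eq ?_
        calc _ = r * c.outcome * (t * cj.outcome) * prodSign c.pauli cj.pauli *
              (prodSign c.assoc cj.assoc * prodSign c.assoc cj.assoc) := by
                simp only [Tracked.mul]; ac_rfl
          _ = _ := by rw [Int.units_mul_self, mul_one]
      · obtain ⟨r, hr, hrc⟩ := (hC c hc').2 hcm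
        exact ⟨r, hr, hrc.eigenProj _ hs⟩
  · intro C V₁ V₂ mj hmj hw _ hV hC
    obtain ⟨hm, hV⟩ := List.forall_mem_cons.1 hV
    have hC := forall_mem_map_ite.1 hC
    have hV := forall_mem_map_ite.1 hV
    have hj := mem_insert_middle (a := mj) (L₁ := V₁) (L₂ := V₂).2 (.inl rfl)
    -- Here the value to be restored is the outcome recorded for `mj`.
    refine ⟨eigenProj mj.pauli mj.outcome χ, 1 / 2, by norm_num, fun v hv => ?_,
      fun c hc => ?_, HasValue.eigenProj_eigenProj _ hmj hm⟩
    · have hs := hw.comm _ (v.mem_paulis hv C) _ (mj.mem_paulis hj C)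
      rcases mem_insert_middle.1 hv with rfl | hv'
      · exact hasValue_eigenProj _ _ _
      by_cases hvm : symp v.pauli m = 1
      · exact HasValue.of_add hs (((hV v hv').1 hvm).eigenProj _ (symp_add_self_eq_zero hs))
          (hasValue_eigenProj _ _ _)
      · exact ((hV v hv').2 hvm).eigenProj _ hs
    · have hs := hw.comm _ (c.mem_paulis hc _) _ (mj.mem_paulis hj C)
      by_cases hcm : symp c.pauli m = 1
      · obtain ⟨r, hr, hrc⟩ := (hC c hc).1 hcm
        refine ⟨r, hr, HasValue.of_add hs ?_ (hasValue_eigenProj mj.pauli mj.outcome χ)⟩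
        refine (hrc.eigenProj _ (symp_add_self_eq_zero hs)).of_eq ?_
        simp only [Tracked.mulRecorded, mul_assoc]
      · obtain ⟨r, hr, hrc⟩ := (hC c hc).2 hcm
        exact ⟨r, hr, hrc.eigenProj _ hs⟩

/-! ## Sequences of updates -/

theorem Updates.wellFormed {n : ℕ} {ms : List (SignedPauli n)} {os : List ℤˣ}
    {C C' : List (Tracked n)} {V V' : List (Recorded n)} {S : Submodule (ZMod 2) (Pauli n)}
    (h : Updates ms os C V C' V') (hw : WellFormed S C V) : WellFormed S C' V' := by
  induction h with
  | nil => exact hw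
  | cons _ _ _ _ _ _ _ _ _ _ h _ ih => exact ih (hw.update h)

theorem Updates.valid {n : ℕ} {ms : List (SignedPauli n)} {os : List ℤˣ}
    {C C' : List (Tracked n)} {V V' : List (Recorded n)} {S : Submodule (ZMod 2) (Pauli n)}
    {ψ φ : QState n} (h : Updates ms os C V C' V') (hS : ∀ s ∈ S, ∀ t ∈ S, symp s t = 0)
    (hw : WellFormed S C V) (hV : ValidV φ V) (hC : ValidC ψ φ C) :
    ValidV (postState ms os φ) V' ∧ ValidC ψ (postState ms os φ) C' := by
  induction h generalizing φ with
  | nil => exact ⟨hV, hC⟩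
  | cons _ _ _ _ _ _ _ _ _ _ h _ ih =>
    rw [postState_cons]
    exact ih (hw.update h) (hV.update hw h) (hC.update hS hV hw h)

/-- The steps are inverted from the last to the first, and linearity collects the factors. The
reference `ψ` stays fixed and need not be related to `φ`, which only witnesses that the record is
possible. -/
theorem Updates.exists_preimage {n : ℕ} {ms : List (SignedPauli n)} {os : List ℤˣ}
    {C C' : List (Tracked n)} {V V' : List (Recorded n)} {S : Submodule (ZMod 2) (Pauli n)}
    {ψ φ χ : QState n} (h : Updates ms os C V C' V') (hS : ∀ s ∈ S, ∀ t ∈ S, symp s t = 0)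
    (hw : WellFormed S C V) (hφ : ValidV φ V) (hφm : postState ms os φ ≠ 0) (hψ : ψ ≠ 0)
    (hψS : ∀ s ∈ S, ∃ r, HasValue s r ψ) (hV : ValidV χ V') (hC : ValidC ψ χ C') :
    ∃ (φ' : QState n) (k : ℂ), k ≠ 0 ∧ ValidV φ' V ∧ ValidC ψ φ' C ∧
      postState ms os φ' = k • χ := by
  induction h generalizing φ with
  | nil => exact ⟨χ, 1, one_ne_zero, hV, hC, by rw [one_smul, postState_nil]⟩
  | cons m ms o os _ _ _ _ _ _ h _ ih =>
    rw [postState_cons] at hφm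
    obtain ⟨φ₁, k₁, hk₁, hV₁, hC₁, h₁⟩ := ih (hw.update h) (hφ.update hw h) hφm hV hC
    obtain ⟨φ₂, k₂, hk₂, hV₂, hC₂, h₂⟩ := h.exists_preimage hS hw hφ
      (ne_zero_of_postState_ne_zero hφm) hψ hψS hV₁ hC₁
    exact ⟨φ₂, k₂ * k₁, mul_ne_zero hk₂ hk₁, hV₂, hC₂, by
      rw [postState_cons, h₂, postState_smul, h₁, smul_smul]⟩

theorem exists_update {n : ℕ} (m : Pauli n) (o : ℤˣ) (C : List (Tracked n))
    (V : List (Recorded n)) : ∃ C' V', Update m o C V C' V' := by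
  by_cases hV : ∀ v ∈ V, symp v.pauli m = 0
  · by_cases hC : ∀ c ∈ C, symp c.pauli m = 0
    · by_cases hm : m ∈ spanRecorded V
      · exact ⟨_, _, .case1_keep C V hC hV hm⟩
      · exact ⟨_, _, .case1_add C V hC hV hm⟩
    · push Not at hC
      obtain ⟨c, hc, hcm⟩ := hC
      obtain ⟨C₁, C₂, rfl⟩ := List.append_of_mem hc
      exact ⟨_, _, .case2 C₁ C₂ c V ((zmod_two_cases _).resolve_left hcm) hV⟩
  · push Not at hV
    obtain ⟨v, hv, hvm⟩ := hV
    obtain ⟨V₁, V₂, rfl⟩ := List.append_of_mem hv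
    have hvm := (zmod_two_cases _).resolve_left hvm
    by_cases hC : ∃ c ∈ C, symp c.pauli m = 1
    · exact ⟨_, _, .case4 C V₁ V₂ v hC hvm⟩
    · push Not at hC
      exact ⟨_, _, .case3 C V₁ V₂ v (fun c hc => eq_zero_of_ne_one (hC c hc)) hvm⟩

theorem exists_updates {n : ℕ} (ms : List (SignedPauli n)) (os : List ℤˣ)
    (hl : os.length = ms.length) (C : List (Tracked n)) (V : List (Recorded n)) :
    ∃ C' V', Updates ms os C V C' V' := by
  induction ms generalizing os C V with
  | nil =>
    obtain rfl := List.length_eq_zero_iff.1 hl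
    exact ⟨C, V, .nil C V⟩
  | cons m ms ih =>
    cases os with
    | nil => simp at hl
    | cons o os =>
      obtain ⟨C₁, V₁, h₁⟩ := exists_update m.pauli (m.sign * o) C V
      obtain ⟨C₂, V₂, h₂⟩ := ih os (by simpa using hl) C₁ V₁
      exact ⟨C₂, V₂, .cons _ _ _ _ _ _ _ _ _ _ h₁ h₂⟩

/-! ## Independence of the Paulis from the outcomes -/

/-- The Pauli and the associated stabilizer, without the outcome. -/
def Tracked.pair {n : ℕ} (c : Tracked n) : Pauli n × Pauli n := (c.pauli, c.assoc)

/-- Here `g` forgets outcomes: `f` and `f'` may record different outcomes as long as they act alike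
on what remains. -/
theorem map_ite_eq_map_ite {α β : Type*} {g : α → β} {p : β → Prop} [DecidablePred p]
    {f f' : α → α} {h : β → β} (hf : ∀ x, g (f x) = h (g x)) (hf' : ∀ x, g (f' x) = h (g x))
    {L L' : List α} (hL : L'.map g = L.map g) :
    (L'.map fun x => if p (g x) then f' x else x).map g =
      (L.map fun x => if p (g x) then f x else x).map g := by
  have key : ∀ (f : α → α), (∀ x, g (f x) = h (g x)) → ∀ L : List α,
      (L.map fun x => if p (g x) then f x else x).map g =
        (L.map g).map fun y => if p y then h y else y := by
    intro f hf L
    rw [List.map_map, List.map_map]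
    refine List.map_congr_left fun x _ => ?_
    simp only [Function.comp_apply]
    split_ifs
    exacts [hf x, rfl]
  rw [key f hf, key f' hf', hL]

theorem map_eq_map_insert_middle {α β : Type*} {g : α → β} {L₁ L₂ L : List α} {x : α}
    (h : L.map g = (L₁ ++ x :: L₂).map g) :
    ∃ K₁ y K₂, L = K₁ ++ y :: K₂ ∧ g y = g x ∧ (K₁ ++ K₂).map g = (L₁ ++ L₂).map g := by
  rw [List.map_append, List.map_cons, List.map_eq_append_iff] at h
  obtain ⟨K₁, K, rfl, h₁, h₂⟩ := h
  obtain ⟨y, K₂, rfl, hy, h₃⟩ := List.map_eq_cons_iff.1 h₂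
  exact ⟨K₁, y, K₂, rfl, hy, by rw [List.map_append, List.map_append, h₁, h₃]⟩

theorem forall_mem_iff_of_map_eq {α β : Type*} {g : α → β} {L L' : List α}
    (h : L'.map g = L.map g) (p : β → Prop) : (∀ x ∈ L', p (g x)) ↔ ∀ x ∈ L, p (g x) := by
  rw [← List.forall_mem_map, h, List.forall_mem_map]

theorem spanRecorded_congr {n : ℕ} {V V' : List (Recorded n)}
    (h : V'.map Recorded.pauli = V.map Recorded.pauli) : spanRecorded V' = spanRecorded V := by
  have key : ∀ V : List (Recorded n), {p | ∃ v ∈ V, v.pauli = p} = {p | p ∈ V.map (·.pauli)} := by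
    intro V
    ext p
    simp
  rw [spanRecorded, spanRecorded, key, key]
  exact congrArg (fun L => Submodule.span (ZMod 2) {p | p ∈ L}) h

/-- Neither the case distinction nor any new Pauli or associated stabilizer involves an outcome, so
the same choices, at the same list positions, are open for any other outcome. -/
theorem Update.replay {n : ℕ} {m : Pauli n} {o : ℤˣ} {C C' D : List (Tracked n)}
    {V V' W : List (Recorded n)} (h : Update m o C V C' V')
    (hD : D.map Tracked.pair = C.map Tracked.pair)
    (hW : W.map Recorded.pauli = V.map Recorded.pauli) (o' : ℤˣ) :
    ∃ D' W', Update m o' D W D' W' ∧ D'.map Tracked.pair = C'.map Tracked.pair ∧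
      W'.map Recorded.pauli = V'.map Recorded.pauli := by
  have eqC : ∀ {C D : List (Tracked n)}, D.map Tracked.pair = C.map Tracked.pair →
      (∀ c ∈ C, symp c.pauli m = 0) → ∀ c ∈ D, symp c.pauli m = 0 := fun h =>
    (forall_mem_iff_of_map_eq (g := Tracked.pair) h fun x => symp x.1 m = 0).2
  have eqV : ∀ {V W : List (Recorded n)}, W.map Recorded.pauli = V.map Recorded.pauli →
      (∀ v ∈ V, symp v.pauli m = 0) → ∀ v ∈ W, symp v.pauli m = 0 := fun h =>
    (forall_mem_iff_of_map_eq h fun x => symp x m = 0).2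
  have replV : ∀ {V W : List (Recorded n)} {v w : Recorded n}, w.pauli = v.pauli →
      W.map Recorded.pauli = V.map Recorded.pauli →
      (W.map fun x => if symp x.pauli m = 1 then x.mul w else x).map Recorded.pauli =
        (V.map fun x => if symp x.pauli m = 1 then x.mul v else x).map Recorded.pauli := by
    intro V W v w hvw hVW
    exact map_ite_eq_map_ite (p := fun q => symp q m = 1) (h := fun q => q + v.pauli)
      (fun _ => rfl) (fun _ => by rw [← hvw]; rfl) hVW
  cases h with
  | case1_add _ _ hC hV hm =>
    exact ⟨_, _, .case1_add D W (eqC hD hC) (eqV hW hV) (by rwa [spanRecorded_congr hW]), hD,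
      by rw [List.map_cons, List.map_cons, hW]⟩
  | case1_keep _ _ hC hV hm =>
    exact ⟨_, _, .case1_keep D W (eqC hD hC) (eqV hW hV) (by rwa [spanRecorded_congr hW]), hD, hW⟩
  | case2 C₁ C₂ cj _ hc hV =>
    obtain ⟨D₁, dj, D₂, rfl, hj, hD'⟩ := map_eq_map_insert_middle hD
    have hj1 : dj.pauli = cj.pauli := congrArg Prod.fst hj
    refine ⟨_, _, .case2 D₁ D₂ dj W (by rwa [hj1]) (eqV hW hV), ?_,
      by rw [List.map_cons, List.map_cons, hW]⟩
    exact map_ite_eq_map_ite (g := Tracked.pair) (p := fun q => symp q.1 m = 1)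
      (h := fun q => q + cj.pair) (fun _ => rfl) (fun _ => by rw [← hj]; rfl) hD'
  | case3 _ V₁ V₂ mj hC hv =>
    obtain ⟨W₁, wj, W₂, rfl, hj, hW'⟩ := map_eq_map_insert_middle hW
    refine ⟨_, _, .case3 D W₁ W₂ wj (eqC hD hC) (by rwa [hj]), hD, ?_⟩
    rw [List.map_cons, List.map_cons, replV hj hW']
  | case4 _ V₁ V₂ mj hC hv =>
    obtain ⟨W₁, wj, W₂, rfl, hj, hW'⟩ := map_eq_map_insert_middle hW
    refine ⟨_, _, .case4 D W₁ W₂ wj ?_ (by rwa [hj]), ?_, ?_⟩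
    · by_contra! hcon
      obtain ⟨c, hc, hcm⟩ := hC
      exact (forall_mem_iff_of_map_eq (g := Tracked.pair) hD
        fun x => symp x.1 m ≠ 1).1 hcon c hc hcm
    · exact map_ite_eq_map_ite (g := Tracked.pair) (p := fun q => symp q.1 m = 1)
        (h := fun q => (q.1 + mj.pauli, q.2)) (fun _ => rfl) (fun _ => by rw [← hj]; rfl) hD
    · rw [List.map_cons, List.map_cons, replV hj hW']

theorem Updates.replay {n : ℕ} {ms : List (SignedPauli n)} {os os' : List ℤˣ}
    {C C' D : List (Tracked n)} {V V' W : List (Recorded n)} (h : Updates ms os C V C' V')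
    (hl : os'.length = ms.length) (hD : D.map Tracked.pair = C.map Tracked.pair)
    (hW : W.map Recorded.pauli = V.map Recorded.pauli) :
    ∃ D' W', Updates ms os' D W D' W' ∧ D'.map Tracked.pair = C'.map Tracked.pair ∧
      W'.map Recorded.pauli = V'.map Recorded.pauli := by
  induction h generalizing os' D W with
  | nil =>
    obtain rfl := List.length_eq_zero_iff.1 hl
    exact ⟨D, W, .nil D W, hD, hW⟩
  | cons m ms o os _ _ _ _ _ _ h _ ih =>
    cases os' with
    | nil => simp at hl
    | cons o' os' =>
      obtain ⟨D₁, W₁, h₁, hD₁, hW₁⟩ := h.replay hD hW (m.sign * o')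
      obtain ⟨D₂, W₂, h₂, hD₂, hW₂⟩ := ih (by simpa using hl) hD₁ hW₁
      exact ⟨D₂, W₂, .cons _ _ _ _ _ _ _ _ _ _ h₁ h₂, hD₂, hW₂⟩

/-! ## Generated groups as products of sublists -/

/-- Coefficients in `ZMod 2` are `0` or `1`, so a linear combination is a choice of a sublist. -/
theorem mem_span_iff_exists_sublist {α M : Type*} [AddCommGroup M] [Module (ZMod 2) M]
    (f : α → M) (L : List α) (x : M) :
    x ∈ Submodule.span (ZMod 2) {y | ∃ a ∈ L, f a = y} ↔
      ∃ K : List α, K.Sublist L ∧ (K.map f).sum = x := by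
  constructor
  · intro hx
    induction L generalizing x with
    | nil => exact ⟨[], .slnil, by simpa [eq_comm] using hx⟩
    | cons a L ih =>
      have hset : {y | ∃ b ∈ a :: L, f b = y} = insert (f a) {y | ∃ b ∈ L, f b = y} := by
        ext y
        simp [eq_comm]
      rw [hset, Submodule.mem_span_insert] at hx
      obtain ⟨k, z, hz, rfl⟩ := hx
      obtain ⟨K, hK, rfl⟩ := ih z hz
      rcases zmod_two_cases k with rfl | rfl
      · exact ⟨K, hK.cons a, by rw [zero_smul, zero_add]⟩
      · exact ⟨a :: K, hK.cons_cons a, by rw [one_smul, List.map_cons, List.sum_cons]⟩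
  · rintro ⟨K, hK, rfl⟩
    refine list_sum_mem (List.forall_mem_map.2 fun a ha => ?_)
    exact Submodule.subset_span ⟨a, hK.subset ha, rfl⟩

theorem Recorded.prod_pauli {n : ℕ} (L : List (Recorded n)) :
    (Recorded.prod L).pauli = (L.map Recorded.pauli).sum := by
  induction L with
  | nil => rfl
  | cons v L ih => rw [List.map_cons, List.sum_cons, ← ih]; rfl

theorem Tracked.prod_pair {n : ℕ} (L : List (Tracked n)) :
    (Tracked.prod L).pair = (L.map Tracked.pair).sum := by
  induction L with
  | nil => rfl
  | cons v L ih => rw [List.map_cons, List.sum_cons, ← ih]; rfl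

theorem mem_spanRecorded_iff {n : ℕ} {V : List (Recorded n)} {p : Pauli n} :
    p ∈ spanRecorded V ↔ ∃ w : Recorded n, w.IsProductOf V ∧ w.pauli = p := by
  rw [spanRecorded, mem_span_iff_exists_sublist]
  constructor
  · rintro ⟨K, hK, rfl⟩
    exact ⟨_, ⟨K, hK, rfl⟩, Recorded.prod_pauli K⟩
  · rintro ⟨_, ⟨K, hK, rfl⟩, rfl⟩
    exact ⟨K, hK, (Recorded.prod_pauli K).symm⟩

/-- The group generated by `C`, with the associated stabilizers. -/
def spanPair {n : ℕ} (C : List (Tracked n)) : Submodule (ZMod 2) (Pauli n × Pauli n) :=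
  Submodule.span (ZMod 2) {x | ∃ c ∈ C, c.pair = x}

theorem mem_spanPair_iff {n : ℕ} {C : List (Tracked n)} {x : Pauli n × Pauli n} :
    x ∈ spanPair C ↔ ∃ e : Tracked n, e.IsProductOf C ∧ e.pair = x := by
  rw [spanPair, mem_span_iff_exists_sublist]
  constructor
  · rintro ⟨K, hK, rfl⟩
    exact ⟨_, ⟨K, hK, rfl⟩, Tracked.prod_pair K⟩
  · rintro ⟨_, ⟨K, hK, rfl⟩, rfl⟩
    exact ⟨K, hK, (Tracked.prod_pair K).symm⟩

theorem spanPair_congr {n : ℕ} {C D : List (Tracked n)}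
    (h : D.map Tracked.pair = C.map Tracked.pair) : spanPair D = spanPair C := by
  have key : ∀ C : List (Tracked n), {p | ∃ c ∈ C, c.pair = p} = {p | p ∈ C.map Tracked.pair} := by
    intro C
    ext p
    simp
  rw [spanPair, spanPair, key, key, h]

theorem map_fst_spanPair {n : ℕ} (C : List (Tracked n)) :
    (spanPair C).map (LinearMap.fst (ZMod 2) (Pauli n) (Pauli n)) = spanTracked C := by
  rw [spanPair, spanTracked, Submodule.map_span]
  congr 1
  ext p
  simp [Tracked.pair]

theorem map_snd_spanPair {n : ℕ} (C : List (Tracked n)) :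
    (spanPair C).map (LinearMap.snd (ZMod 2) (Pauli n) (Pauli n)) =
      Submodule.span (ZMod 2) {s | ∃ c ∈ C, c.assoc = s} := by
  rw [spanPair, Submodule.map_span]
  congr 1
  ext p
  simp [Tracked.pair]

/-- The stabilizers that are associated with elements of `⟨C⟩ ∩ ⟨V⟩`. -/
def unmaskedSpan {n : ℕ} (C : List (Tracked n)) (V : List (Recorded n)) :
    Submodule (ZMod 2) (Pauli n) :=
  (spanPair C ⊓ (spanRecorded V).comap (LinearMap.fst (ZMod 2) (Pauli n) (Pauli n))).map
    (LinearMap.snd (ZMod 2) (Pauli n) (Pauli n))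

theorem mem_unmaskedSpan_iff {n : ℕ} {C : List (Tracked n)} {V : List (Recorded n)}
    {s : Pauli n} : s ∈ unmaskedSpan C V ↔ ∃ x, (x, s) ∈ spanPair C ∧ x ∈ spanRecorded V := by
  simp [unmaskedSpan, Submodule.mem_map]

theorem Recorded.prod_hasValue {n : ℕ} {L : List (Recorded n)} {φ : QState n}
    (hL : ValidV φ L) (hc : ∀ v ∈ L, ∀ w ∈ L, symp v.pauli w.pauli = 0) :
    HasValue (Recorded.prod L).pauli (Recorded.prod L).outcome φ := by
  induction L with
  | nil => exact hasValue_zero φ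
  | cons v L ih =>
    obtain ⟨hv, hL⟩ := List.forall_mem_cons.1 hL
    have ih := ih hL fun a ha b hb => hc a (.tail _ ha) b (.tail _ hb)
    have hp : (Recorded.prod L).pauli ∈ spanRecorded (v :: L) :=
      mem_spanRecorded_iff.2 ⟨_, ⟨L, List.sublist_cons_self v L, rfl⟩, rfl⟩
    have hs : symp v.pauli (Recorded.prod L).pauli = 0 := by
      refine symp_span_eq_zero (S := {p | ∃ a ∈ v :: L, a.pauli = p}) ?_
        (Submodule.subset_span ⟨v, .head _, rfl⟩) hp
      rintro _ ⟨a, ha, rfl⟩ _ ⟨b, hb, rfl⟩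
      exact hc a ha b hb
    exact hv.add hs ih

theorem Recorded.IsProductOf.hasValue {n : ℕ} {w : Recorded n} {V : List (Recorded n)}
    {φ : QState n} (h : w.IsProductOf V) (hV : ValidV φ V)
    (hc : ∀ v ∈ V, ∀ w ∈ V, symp v.pauli w.pauli = 0) : HasValue w.pauli w.outcome φ := by
  obtain ⟨L, hL, rfl⟩ := h
  exact Recorded.prod_hasValue (fun v hv => hV v (hL.subset hv))
    fun a ha b hb => hc a (hL.subset ha) b (hL.subset hb)

theorem Tracked.prod_hasValue {n : ℕ} {L : List (Tracked n)} {ψ φ : QState n}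
    (hL : ValidC ψ φ L) (hc : ∀ c ∈ L, ∀ d ∈ L, symp c.pauli d.pauli = 0)
    (ha : ∀ c ∈ L, ∀ d ∈ L, symp c.assoc d.assoc = 0) :
    ∃ r, HasValue (Tracked.prod L).assoc r ψ ∧
      HasValue (Tracked.prod L).pauli (r * (Tracked.prod L).outcome) φ := by
  induction L with
  | nil => exact ⟨1, hasValue_zero ψ, hasValue_zero φ⟩
  | cons c L ih =>
    obtain ⟨⟨r, hr, hr'⟩, hL⟩ := List.forall_mem_cons.1 hL
    obtain ⟨t, ht, ht'⟩ := ih hL (fun a ha b hb => hc a (.tail _ ha) b (.tail _ hb))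
      fun a ha' b hb => ha a (.tail _ ha') b (.tail _ hb)
    have hp : (Tracked.prod L).pair ∈ spanPair (c :: L) :=
      mem_spanPair_iff.2 ⟨_, ⟨L, List.sublist_cons_self c L, rfl⟩, rfl⟩
    have hp₁ := Submodule.mem_map_of_mem (f := LinearMap.fst (ZMod 2) (Pauli n) (Pauli n)) hp
    have hp₂ := Submodule.mem_map_of_mem (f := LinearMap.snd (ZMod 2) (Pauli n) (Pauli n)) hp
    rw [map_fst_spanPair] at hp₁
    rw [map_snd_spanPair] at hp₂
    have hs₁ : symp c.pauli (Tracked.prod L).pauli = 0 := by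
      refine symp_span_eq_zero (S := {p | ∃ a ∈ c :: L, a.pauli = p}) ?_
        (Submodule.subset_span ⟨c, .head _, rfl⟩) hp₁
      rintro _ ⟨a, ha, rfl⟩ _ ⟨b, hb, rfl⟩
      exact hc a ha b hb
    have hs₂ : symp c.assoc (Tracked.prod L).assoc = 0 := by
      refine symp_span_eq_zero (S := {p | ∃ a ∈ c :: L, a.assoc = p}) ?_
        (Submodule.subset_span ⟨c, .head _, rfl⟩) hp₂
      rintro _ ⟨a, ha', rfl⟩ _ ⟨b, hb, rfl⟩
      exact ha a ha' b hb
    refine ⟨_, hr.add hs₂ ht, (hr'.add hs₁ ht').of_eq ?_⟩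
    change _ = _ * (c.mul (Tracked.prod L)).outcome
    calc _ = r * c.outcome * (t * (Tracked.prod L).outcome) *
            prodSign c.pauli (Tracked.prod L).pauli *
            (prodSign c.assoc (Tracked.prod L).assoc * prodSign c.assoc (Tracked.prod L).assoc) := by
          rw [Int.units_mul_self, mul_one]
      _ = _ := by simp only [Tracked.mul]; ac_rfl

/-- The common Pauli has value `w.outcome` through `V` and `r * e.outcome` through `C`, where `r` is
the value of `e.assoc` in `ψ`. Since `φ ≠ 0` these agree, which determines `r`. -/
theorem WellFormed.hasValue {n : ℕ} {S : Submodule (ZMod 2) (Pauli n)} {C : List (Tracked n)}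
    {V : List (Recorded n)} {ψ φ : QState n} (hw : WellFormed S C V)
    (hS : ∀ s ∈ S, ∀ t ∈ S, symp s t = 0) (hφ : φ ≠ 0) (hV : ValidV φ V) (hC : ValidC ψ φ C)
    {e : Tracked n} {w : Recorded n} (he : e.IsProductOf C) (hwV : w.IsProductOf V)
    (hew : w.pauli = e.pauli) : HasValue e.assoc (w.outcome * e.outcome) ψ := by
  obtain ⟨L, hL, rfl⟩ := he
  obtain ⟨r, hr, hr'⟩ := Tracked.prod_hasValue (fun c hc => hC c (hL.subset hc))
    (fun a ha b hb => hw.comm _ (a.mem_paulis (hL.subset ha) V) _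
      (b.mem_paulis (hL.subset hb) V))
    (fun a ha b hb => hS _ (hw.assoc_mem a (hL.subset ha)) _ (hw.assoc_mem b (hL.subset hb)))
  have hv := hwV.hasValue hV fun a ha b hb =>
    hw.comm _ (a.mem_paulis ha C) _ (b.mem_paulis hb C)
  rw [hew] at hv
  refine hr.of_eq ?_
  rw [hv.unique hφ hr', mul_assoc, Int.units_mul_self, mul_one]

/-! ## The intersection and the output -/

/-- Generators of the intersection reach each `x` in it with some associated stabilizer `t`, perhaps
not the prescribed `s`. The difference `s - t` belongs to a product of `C` with trivial Pauli, and
is covered by the redundancies. -/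
theorem IsIntersection.span_assoc {n : ℕ} {C Ut : List (Tracked n)} {V : List (Recorded n)}
    (h : IsIntersection C V Ut) :
    Submodule.span (ZMod 2) {s | ∃ u ∈ Ut, u.assoc = s} = unmaskedSpan C V := by
  have hle : spanPair Ut ≤ spanPair C := by
    refine Submodule.span_le.2 ?_
    rintro _ ⟨u, hu, rfl⟩
    exact mem_spanPair_iff.2 ⟨u, h.product u hu, rfl⟩
  apply le_antisymm
  · refine Submodule.span_le.2 ?_
    rintro _ ⟨u, hu, rfl⟩
    have hu' : u.pauli ∈ spanTracked Ut := Submodule.subset_span ⟨u, hu, rfl⟩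
    rw [h.generates] at hu'
    exact mem_unmaskedSpan_iff.2
      ⟨u.pauli, mem_spanPair_iff.2 ⟨u, h.product u hu, rfl⟩, hu'.2⟩
  · intro s hs
    obtain ⟨x, hxs, hxV⟩ := mem_unmaskedSpan_iff.1 hs
    have hx : x ∈ spanTracked Ut := by
      rw [h.generates]
      refine ⟨?_, hxV⟩
      rw [← map_fst_spanPair]
      exact ⟨_, hxs, rfl⟩
    rw [← map_fst_spanPair] at hx
    obtain ⟨⟨x, t⟩, hxt, rfl⟩ := hx
    obtain ⟨e, he, hes⟩ := mem_spanPair_iff.1 (sub_mem hxs (hle hxt))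
    have he₁ : e.pauli = 0 := (congrArg Prod.fst hes).trans (sub_self x)
    have he₂ : e.assoc = s - t := congrArg Prod.snd hes
    have hst := h.redundancies e he he₁
    rw [he₂] at hst
    have ht : t ∈ Submodule.span (ZMod 2) {s | ∃ u ∈ Ut, u.assoc = s} := by
      rw [← map_snd_spanPair]
      exact ⟨_, hxt, rfl⟩
    rw [← sub_add_cancel s t]
    refine add_mem (Submodule.span_mono ?_ hst) ht
    rintro _ ⟨u, hu, _, rfl⟩
    exact ⟨u, hu, rfl⟩

theorem exists_isIntersection {n : ℕ} (C : List (Tracked n)) (V : List (Recorded n)) :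
    ∃ Ut, IsIntersection C V Ut := by
  classical
  -- No minimality is demanded, so all products of `C` that lie in `⟨V⟩` can be taken.
  refine ⟨(C.sublists.map Tracked.prod).filter fun u => u.pauli ∈ spanRecorded V, ?_⟩
  have hmem : ∀ u : Tracked n, u ∈ ((C.sublists.map Tracked.prod).filter
      fun u => u.pauli ∈ spanRecorded V) ↔ u.IsProductOf C ∧ u.pauli ∈ spanRecorded V := by
    intro u
    simp [Tracked.IsProductOf]
  refine ⟨fun u hu => ((hmem u).1 hu).1, ?_, fun e he he0 => ?_⟩
  · apply le_antisymm
    · refine Submodule.span_le.2 ?_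
      rintro _ ⟨u, hu, rfl⟩
      obtain ⟨hu, huV⟩ := (hmem u).1 hu
      refine ⟨?_, huV⟩
      rw [← map_fst_spanPair]
      exact ⟨_, mem_spanPair_iff.2 ⟨u, hu, rfl⟩, rfl⟩
    · rintro x ⟨hxC, hxV⟩
      rw [← map_fst_spanPair] at hxC
      obtain ⟨y, hy, rfl⟩ := hxC
      obtain ⟨e, he, rfl⟩ := mem_spanPair_iff.1 hy
      exact Submodule.subset_span ⟨e, (hmem e).2 ⟨he, hxV⟩, rfl⟩
  · exact Submodule.subset_span ⟨e, (hmem e).2 ⟨he, he0 ▸ zero_mem _⟩, he0, rfl⟩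

theorem spanRecorded_cons {n : ℕ} (v : Recorded n) (V : List (Recorded n)) :
    spanRecorded (v :: V) = Submodule.span (ZMod 2) {v.pauli} ⊔ spanRecorded V := by
  rw [spanRecorded, spanRecorded, ← Submodule.span_union]
  congr 1
  ext p
  simp [eq_comm]

theorem span_assoc_cons {n : ℕ} (u : Tracked n) (us : List (Tracked n)) :
    Submodule.span (ZMod 2) {s | ∃ c ∈ u :: us, c.assoc = s} =
      Submodule.span (ZMod 2) {u.assoc} ⊔
        Submodule.span (ZMod 2) {s | ∃ c ∈ us, c.assoc = s} := by
  rw [← Submodule.span_union]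
  congr 1
  ext p
  simp [eq_comm]

theorem Extract.span_eq {n : ℕ} {V : List (Recorded n)} {us : List (Tracked n)}
    {U U' : List (Recorded n)} (h : Extract V us U U') :
    spanRecorded U' = spanRecorded U ⊔ Submodule.span (ZMod 2) {s | ∃ u ∈ us, u.assoc = s} := by
  induction h with
  | nil U => simp
  | skip u us U U' h _ ih =>
    rw [ih, span_assoc_cons, ← sup_assoc,
      sup_eq_left.2 ((Submodule.span_singleton_le_iff_mem _ _).2 h)]
  | add u us U U' w h _ _ _ ih =>
    rw [ih, span_assoc_cons, spanRecorded_cons, ← sup_assoc]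
    congr 1
    exact sup_comm _ _

theorem Extract.linearIndependent {n : ℕ} {V : List (Recorded n)} {us : List (Tracked n)}
    {U U' : List (Recorded n)} (h : Extract V us U U')
    (hU : LinearIndependent (ZMod 2) (fun i : Fin U.length => (U.get i).pauli)) :
    LinearIndependent (ZMod 2) (fun i : Fin U'.length => (U'.get i).pauli) := by
  induction h with
  | nil U => exact hU
  | skip _ _ _ _ _ _ ih => exact ih hU
  | add u us U U' w h _ _ _ ih =>
    refine ih (linearIndependent_finSucc.2 ⟨hU, fun hmem => h (Submodule.span_mono ?_ hmem)⟩)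
    rintro _ ⟨i, rfl⟩
    exact ⟨U.get i, U.get_mem i, rfl⟩

theorem Extract.forall_mem {n : ℕ} {V : List (Recorded n)} {us : List (Tracked n)}
    {U U' : List (Recorded n)} (h : Extract V us U U') {P : Recorded n → Prop}
    (hU : ∀ v ∈ U, P v) (hus : ∀ u ∈ us, ∀ w : Recorded n, w.IsProductOf V → w.pauli = u.pauli →
      P ⟨u.assoc, w.outcome * u.outcome⟩) : ∀ v ∈ U', P v := by
  induction h with
  | nil U => exact hU
  | skip _ _ _ _ _ _ ih => exact ih hU fun u hu => hus u (.tail _ hu)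
  | add u us U U' w _ hw hu _ ih =>
    exact ih (List.forall_mem_cons.2 ⟨hus u (.head _) w hw hu, hU⟩)
      fun u hu => hus u (.tail _ hu)

theorem exists_extract {n : ℕ} {V : List (Recorded n)} {us : List (Tracked n)}
    (h : ∀ u ∈ us, u.pauli ∈ spanRecorded V) (U : List (Recorded n)) :
    ∃ U', Extract V us U U' := by
  induction us generalizing U with
  | nil => exact ⟨U, .nil U⟩
  | cons u us ih =>
    obtain ⟨hu, hus⟩ := List.forall_mem_cons.1 h
    by_cases hU : u.assoc ∈ spanRecorded U
    · obtain ⟨U', hU'⟩ := ih hus U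
      exact ⟨U', .skip u us U U' hU hU'⟩
    · obtain ⟨w, hw, hwu⟩ := mem_spanRecorded_iff.1 hu
      obtain ⟨U', hU'⟩ := ih hus (⟨u.assoc, w.outcome * u.outcome⟩ :: U)
      exact ⟨U', .add u us U U' w hU hw hwu hU'⟩

/-! ## Unmasked stabilizers -/

/-- The initial list `C`. -/
abbrev DynamicalCode.initialC {n : ℕ} (Q : DynamicalCode n) : List (Tracked n) :=
  Q.S₀.map fun s => ⟨s, s, 1⟩

theorem DynamicalCode.isg₀_comm {n : ℕ} (Q : DynamicalCode n) :
    ∀ s ∈ Q.isg₀, ∀ t ∈ Q.isg₀, symp s t = 0 :=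
  fun _ hs _ ht => symp_span_eq_zero Q.S₀_comm hs ht

theorem DynamicalCode.wellFormed_initial {n : ℕ} (Q : DynamicalCode n) :
    WellFormed Q.isg₀ Q.initialC [] := by
  refine ⟨List.forall_mem_map.2 fun s hs => Submodule.subset_span hs, ?_⟩
  have key : ∀ p ∈ paulis Q.initialC [], p ∈ Q.S₀ := by
    rintro _ (⟨c, hc, rfl⟩ | ⟨v, hv, rfl⟩)
    · obtain ⟨s, hs, rfl⟩ := List.mem_map.1 hc
      exact hs
    · simp at hv
  exact fun p hp q hq => Q.S₀_comm p (key p hp) q (key q hq)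

theorem validV_nil {n : ℕ} (φ : QState n) : ValidV φ [] := by simp [ValidV]

theorem DynamicalCode.validC_initial_iff {n : ℕ} {Q : DynamicalCode n} {ψ φ : QState n} :
    ValidC ψ φ Q.initialC ↔ ∀ s ∈ Q.S₀, ∃ o, HasValue s o ψ ∧ HasValue s o φ := by
  rw [ValidC, List.forall_mem_map]
  simp only [mul_one]

theorem DynamicalCode.IsRoundZeroState.validC {n : ℕ} {Q : DynamicalCode n} {ψ : QState n}
    (h : Q.IsRoundZeroState ψ) : ValidC ψ ψ Q.initialC :=
  Q.validC_initial_iff.2 fun s hs => (h s hs).imp fun _ ho => ⟨ho, ho⟩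

theorem DynamicalCode.IsRoundZeroState.exists_hasValue {n : ℕ} {Q : DynamicalCode n}
    {ψ : QState n} (h : Q.IsRoundZeroState ψ) {s : Pauli n} (hs : s ∈ Q.isg₀) :
    ∃ o, HasValue s o ψ := by
  obtain ⟨o, ho, _⟩ := exists_hasValue_span (ψ := ψ) (φ := ψ) Q.isg₀_comm
    (fun s hs => (h s hs).imp fun _ ho => ⟨ho, ho⟩) hs
  exact ⟨o, ho⟩

theorem DynamicalCode.IsRoundZeroState.pauliLin {n : ℕ} {Q : DynamicalCode n} {ψ : QState n}
    (h : Q.IsRoundZeroState ψ) (E : Pauli n) : Q.IsRoundZeroState (pauliLin E ψ) :=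
  fun s hs => (h s hs).elim fun _ ho => ⟨_, ho.pauliLin E⟩

/-- The value which the algorithm computes from a record is the true one. -/
theorem Updates.hasValue_of_isProductOf {n : ℕ} {Q : DynamicalCode n} {ω : List ℤˣ}
    {C : List (Tracked n)} {V : List (Recorded n)}
    (h : Updates Q.measurements ω Q.initialC [] C V) {ψ : QState n}
    (hψ : Q.IsRoundZeroState ψ) (hω : Q.Possible ψ ω) {e : Tracked n} {w : Recorded n}
    (he : e.IsProductOf C) (hw : w.IsProductOf V) (hew : w.pauli = e.pauli) :
    HasValue e.assoc (w.outcome * e.outcome) ψ := by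
  obtain ⟨hV, hC⟩ := h.valid Q.isg₀_comm Q.wellFormed_initial (validV_nil ψ) hψ.validC
  exact (h.wellFormed Q.wellFormed_initial).hasValue Q.isg₀_comm hω hV hC he hw hew

/-- The function `f` replays the run on each record and reads off the value. -/
theorem Updates.isUnmasked {n : ℕ} {Q : DynamicalCode n} {ω : List ℤˣ}
    {C : List (Tracked n)} {V : List (Recorded n)}
    (h : Updates Q.measurements ω Q.initialC [] C V) {s : Pauli n}
    (hs : s ∈ unmaskedSpan C V) : Q.IsUnmasked s := by
  obtain ⟨x, hxs, hxV⟩ := mem_unmaskedSpan_iff.1 hs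
  refine ⟨?_, ?_⟩
  · have hle : Submodule.span (ZMod 2) {s | ∃ c ∈ C, c.assoc = s} ≤ Q.isg₀ := by
      refine Submodule.span_le.2 ?_
      rintro _ ⟨c, hc, rfl⟩
      exact (h.wellFormed Q.wellFormed_initial).assoc_mem c hc
    apply hle
    rw [← map_snd_spanPair]
    exact ⟨_, hxs, rfl⟩
  · have key : ∀ ω' : List ℤˣ, ∃ o, ∀ ψ : QState n, Q.IsRoundZeroState ψ → Q.Possible ψ ω' →
        HasValue s o ψ := by
      intro ω'
      by_cases hl : ω'.length = Q.measurements.length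
      · obtain ⟨D, W, hDW, hD, hW⟩ := h.replay (D := Q.initialC) (W := []) hl rfl rfl
        rw [← spanPair_congr hD] at hxs
        rw [← spanRecorded_congr hW] at hxV
        obtain ⟨e, he, hes⟩ := mem_spanPair_iff.1 hxs
        obtain ⟨w, hw, hwx⟩ := mem_spanRecorded_iff.1 hxV
        obtain rfl : e.assoc = s := congrArg Prod.snd hes
        have hex : e.pauli = x := congrArg Prod.fst hes
        exact ⟨_, fun ψ hψ hω => hDW.hasValue_of_isProductOf hψ hω he hw (hwx.trans hex.symm)⟩
      -- A record of the wrong length is never possible, so the default value `1` is harmless.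
      · exact ⟨1, fun ψ _ hω => absurd (length_eq_of_postState_ne_zero hω) hl⟩
    choose f hf using key
    exact ⟨f, fun ψ hψ ω' hω => hf ω' ψ hψ hω⟩

/-- Paulis `E` and `F` such that `E` fixes the outcomes of `V`, flips `C` in the same way as `F`
flips the associated stabilizers, while `F` flips `s`. -/
theorem exists_flip {n : ℕ} {C : List (Tracked n)} {V : List (Recorded n)} {s : Pauli n}
    (hs : s ∉ unmaskedSpan C V) :
    ∃ E F : Pauli n, (∀ v ∈ V, symp E v.pauli = 0) ∧
      (∀ c ∈ C, symp E c.pauli = symp F c.assoc) ∧ symp F s = 1 := by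
  -- Modulo `⟨V⟩ × 0`, the pair `(0, s)` lies in `spanPair C` exactly if some `(x, s)` with `x ∈
  -- ⟨V⟩` does. A functional separating it from the sum restricts to `E` and `F` on the two factors.
  have hnot : ((0, s) : Pauli n × Pauli n) ∉
      spanPair C ⊔ (spanRecorded V).map (LinearMap.inl (ZMod 2) (Pauli n) (Pauli n)) := by
    intro hmem
    obtain ⟨⟨x, t⟩, hx, _, ⟨v, hv, rfl⟩, hsum⟩ := Submodule.mem_sup.1 hmem
    obtain ⟨hxv, hts⟩ := Prod.ext_iff.1 hsum
    simp only [LinearMap.inl_apply, Prod.fst_add, Prod.snd_add, add_zero] at hxv hts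
    subst hts
    refine hs (mem_unmaskedSpan_iff.2 ⟨x, hx, ?_⟩)
    rw [eq_neg_of_add_eq_zero_left hxv]
    exact neg_mem hv
  obtain ⟨f, hfs, hf⟩ := Submodule.exists_le_ker_of_notMem hnot
  obtain ⟨E, hE⟩ := exists_symp_eq (f ∘ₗ LinearMap.inl _ _ _)
  obtain ⟨F, hF⟩ := exists_symp_eq (f ∘ₗ LinearMap.inr _ _ _)
  refine ⟨E, F, fun v hv => ?_, fun c hc => ?_, ?_⟩
  · rw [← hE]
    exact hf (le_sup_right (a := spanPair C) ⟨_, Submodule.subset_span ⟨v, hv, rfl⟩, rfl⟩)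
  · have h0 : f c.pair = 0 := hf (le_sup_left (a := spanPair C) (Submodule.subset_span ⟨c, hc, rfl⟩))
    have h1 : c.pair = (c.pauli, 0) + (0, c.assoc) := by simp [Tracked.pair]
    rw [h1, map_add] at h0
    rw [← hE, ← hF]
    exact (CharTwo.add_eq_zero).1 h0
  · rw [← hF]
    exact (zmod_two_cases _).resolve_left hfs

theorem Updates.mem_unmaskedSpan {n : ℕ} {Q : DynamicalCode n} {ω : List ℤˣ}
    {C : List (Tracked n)} {V : List (Recorded n)}
    (h : Updates Q.measurements ω Q.initialC [] C V) {s : Pauli n} (hs : Q.IsUnmasked s) :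
    s ∈ unmaskedSpan C V := by
  obtain ⟨hs₀, f, hf⟩ := hs
  obtain ⟨ψ, hψ, hψ₀⟩ := exists_common_eigenstate Q.S₀ Q.S₀_comm
  obtain ⟨ω', hω⟩ := exists_postState_ne_zero Q.measurements hψ
  -- The given record may be impossible in `ψ`, so the run is replayed on a record that is possible.
  obtain ⟨D, W, hDW, hD, hW⟩ := h.replay (D := Q.initialC) (W := [])
    (length_eq_of_postState_ne_zero hω) rfl rfl
  rw [unmaskedSpan, ← spanPair_congr hD, ← spanRecorded_congr hW]
  by_contra hnot
  obtain ⟨E, F, hEV, hEC, hFs⟩ := exists_flip hnot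
  obtain ⟨hV, hC⟩ := hDW.valid Q.isg₀_comm Q.wellFormed_initial (validV_nil ψ)
    (DynamicalCode.IsRoundZeroState.validC hψ₀)
  have hF₀ := DynamicalCode.IsRoundZeroState.pauliLin hψ₀ F
  have hF := pauliLin_ne_zero F hψ
  -- `E` applied to the final state satisfies the final relations with reference `F ψ`, so it comes
  -- from a state `φ` with the signs of `F ψ` on `S₀`.
  obtain ⟨φ, k, hk, _, hφ, hpost⟩ := hDW.exists_preimage (ψ := pauliLin F ψ)
    (χ := pauliLin E (postState Q.measurements ω' ψ)) Q.isg₀_comm Q.wellFormed_initial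
    (validV_nil ψ) hω hF (fun t ht => hF₀.exists_hasValue ht)
    (fun v hv => ((hV v hv).pauliLin E).of_eq (by rw [hEV v hv]; simp))
    (fun c hc => by
      obtain ⟨r, hr, hr'⟩ := hC c hc
      refine ⟨_, hr.pauliLin F, (hr'.pauliLin E).of_eq ?_⟩
      rw [hEC c hc]
      ac_rfl)
  have hφ' := DynamicalCode.validC_initial_iff.1 hφ
  have hφω : Q.Possible φ ω' := by
    rw [DynamicalCode.Possible, hpost]
    exact smul_ne_zero hk (pauliLin_ne_zero E hω)
  have hφ₀ : Q.IsRoundZeroState φ := fun t ht => (hφ' t ht).imp fun _ ho => ho.2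
  obtain ⟨o, ho, ho'⟩ := exists_hasValue_span Q.isg₀_comm hφ' hs₀
  have h₁ := (hf ψ hψ₀ ω' hω).pauliLin F
  have h₂ := ho'.unique (ne_zero_of_postState_ne_zero hφω) (hf φ hφ₀ ω' hφω)
  have h₃ := h₁.unique hF ho
  rw [h₂, hFs, ZMod.val_one, pow_one, mul_neg_one] at h₃
  exact neg_units_ne_self _ h₃

end DynCode

theorem mainTheorem3 {n : ℕ} (Q : DynCode.DynamicalCode n) :
    (∀ ω : List ℤˣ, ω.length = Q.measurements.length →
      ∃ U : List (DynCode.Recorded n), Q.Outputs ω U) ∧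
    ∀ (ω : List ℤˣ) (U : List (DynCode.Recorded n)), Q.Outputs ω U →
      LinearIndependent (ZMod 2) (fun i : Fin U.length => (U.get i).pauli) ∧
      (∀ s : DynCode.Pauli n,
        Q.IsUnmasked s ↔ ∃ w : DynCode.Recorded n, w.IsProductOf U ∧ w.pauli = s) ∧
      (∀ w : DynCode.Recorded n, w.IsProductOf U →
        (∀ ψ : DynCode.QState n, Q.IsRoundZeroState ψ → Q.Possible ψ ω →
          DynCode.HasValue w.pauli w.outcome ψ) ∧
        (∀ (ψ : DynCode.QState n) (E : DynCode.Pauli n) (r : ℤˣ),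
          Q.IsRoundZeroState ψ → DynCode.HasValue w.pauli r ψ →
          Q.Possible ((DynCode.pauliOp E).mulVec ψ) ω →
          w.outcome = r * (-1) ^ (DynCode.symp E w.pauli).val)) := by
  open DynCode in
  refine ⟨fun ω hω => ?_, fun ω U hU => ?_⟩
  · obtain ⟨C, V, hCV⟩ := exists_updates Q.measurements ω hω Q.initialC []
    obtain ⟨Ut, hUt⟩ := exists_isIntersection C V
    obtain ⟨U, hU⟩ := exists_extract (V := V) (us := Ut) (fun u hu => by
      have hu' : u.pauli ∈ spanTracked Ut := Submodule.subset_span ⟨u, hu, rfl⟩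
      rw [hUt.generates] at hu'
      exact hu'.2) []
    exact ⟨U, C, V, Ut, hCV, hUt, hU⟩
  · obtain ⟨C, V, Ut, hCV, hUt, hU⟩ := hU
    have hspan : spanRecorded U = unmaskedSpan C V := by
      rw [hU.span_eq, hUt.span_assoc, spanRecorded]
      simp
    have hiff : ∀ s, Q.IsUnmasked s ↔ s ∈ spanRecorded U := fun s => by
      rw [hspan]
      exact ⟨fun hs => hCV.mem_unmaskedSpan hs, fun hs => hCV.isUnmasked hs⟩
    have hcomm : ∀ v ∈ U, ∀ w ∈ U, symp v.pauli w.pauli = 0 := fun v hv w hw =>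
      Q.isg₀_comm _ ((hiff _).2 (Submodule.subset_span ⟨v, hv, rfl⟩)).1 _
        ((hiff _).2 (Submodule.subset_span ⟨w, hw, rfl⟩)).1
    have hval : ∀ w : Recorded n, w.IsProductOf U → ∀ ψ : QState n, Q.IsRoundZeroState ψ →
        Q.Possible ψ ω → HasValue w.pauli w.outcome ψ := fun w hw ψ hψ hω =>
      hw.hasValue (hU.forall_mem (P := fun v => HasValue v.pauli v.outcome ψ) (by simp)
        fun u hu v hv hvu => hCV.hasValue_of_isProductOf hψ hω (hUt.product u hu) hv hvu) hcomm
    have : IsEmpty (Fin ([] : List (Recorded n)).length) := Fin.isEmpty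
    refine ⟨hU.linearIndependent linearIndependent_empty_type,
      fun s => (hiff s).trans mem_spanRecorded_iff, fun w hw => ⟨hval w hw, ?_⟩⟩
    intro ψ E r hψ hr hω
    -- The state after the error is again a round-0 state, so the outcome is its true value, which
    -- is `r` with the sign from moving `E` past the stabilizer.
    exact (hval w hw _ (hψ.pauliLin E) hω).unique (ne_zero_of_postState_ne_zero hω)
      (hr.pauliLin E)
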